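/- Let $n\ge 2$ and let $M$ be a $4n$-dimensional almost hyper-Hermitian manifold: a smooth manifold with a Riemannian metric $g$ and smooth $g$-orthogonal almost complex structures $I$, $J$, $K=IJ=-JI$. Let $\nabla$ be the Levi-Civita connection of $g$ and $\omega_A(X,Y)=g(X,AY)$ for $A=I,J,K$. For each $A$ write $\mathcal W_1,\dots,\mathcal W_4$ for the Gray--Hervella modules of $(g,A)$. At each point they are subspaces of the space $\mathcal W$ of trilinear forms $\xi$ with $\xi(x;z,y)=-\xi(x;y,z)$ and $\xi(x;Ay,Az)=-\xi(x;y,z)$, namely: - $\mathcal W_1=\{\xi\in\mathcal W:\ \xi(x;x,z)=0\}$, - $\mathcal W_2=\{\xi\in\mathcal W:\ \xi(x;y,z)+\xi(y;z,x)+\xi(z;x,y)=0\}$, - $\mathcal W_3=\{\xi\in\mathcal W:\ \xi(Ax;Ay,z)=\xi(x;y,z),\ \sum_i\xi(e_i;e_i,z)=0\}$, where $(e_i)$ is an orthonormal basis, - $\mathcal W_4=\{\xi:\ \xi(x;y,z)=g(x,y)\theta(z)-g(x,z)\theta(y)-g(x,Ay)\theta(Az)+g(x,Az)\theta(Ay)\text{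 for some one-form }\theta\}$. Suppose that one of the following conditions holds (at every point of $M$): (i) $\nabla\omega_I\in\mathcal W_4$ and $\nabla\omega_J\in\mathcal W_i+\mathcal W_4$ for some $i\in\{1,2,3\}$; (ii) $\nabla\omega_I,\nabla\omega_J\in\mathcal W_i+\mathcal W_4$ for some $i\in\{1,2,3\}$, and $\nabla\omega_K\in\mathcal W_1+\mathcal W_2+\mathcal W_4$; (iii) $\nabla\omega_I\in\mathcal W_i+\mathcal W_4$, $\nabla\omega_J\in\mathcal W_3+\mathcal W_4$ and $\nabla\omega_K\in\mathcal W_j+\mathcal W_3+\mathcal W_4$ for some $i\in\{1,2\}$ and $j\in\{1,2,3\}$ with $i\ne j$; (iv) $\nabla\omega_I\in\mathcal W_1+\mathcal W_4$, $\nabla\omega_J\in\mathcal W_2+\mathcal W_4$ and $\nabla\omega_K\in\mathcal W_i+\mathcal W_j+\mathcal W_4$ for some $i,j\in\{1,2,3\}$ with $i\neq j$; (v) $\nabla\omega_I\in\mathcal W_4$, $\nabla\omega_J\in\mathcal C+\mathcal W_4$ and $\nabla\omega_K\in\mathcal D+\mathcal W_4$ for some $\mathcal C\ne\mathcal D$ among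 $\mathcal W_1+\mathcal W_2$, $\mathcal W_1+\mathcal W_3$, $\mathcal W_2+\mathcal W_3$. Then $M$ is locally conformal hyperKähler: every point has an open neighbourhood $U$ with a smooth function $f$ on $U$ such that $(e^{f}g,I,J,K)$ is hyperKähler on $U$, i.e. the Kähler forms of $I,J,K$ with respect to $e^fg$ are all parallel for the Levi-Civita connection of $e^fg$. -/

import Mathlib

open Set Bundle Manifold
open scoped ContDiff

noncomputable section

namespace HyperHermitian

/-! ### The Gray–Hervella modules of an almost Hermitian vector space -/

section GrayHervella

variable {V : Type*} [AddCommGroup V] [Module ℝ V]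

/-- The space of covariant derivatives of a Kähler form: the tensors `ξ(x; y, z)` on the Hermitian
vector space `(V, g, J)` that are skew in `y, z` and satisfy `ξ(x; Jy, Jz) = -ξ(x; y, z)`. -/
def ghSpace (J : V →ₗ[ℝ] V) : Submodule ℝ (V →ₗ[ℝ] V →ₗ[ℝ] V →ₗ[ℝ] ℝ) where
  carrier := {ξ | ∀ x y z, ξ x z y = -ξ x y z ∧ ξ x (J y) (J z) = -ξ x y z}
  zero_mem' := by simp
  add_mem' := by
    intro a b ha hb x y z
    refine ⟨?_, ?_⟩
    · simp only [LinearMap.add_apply, (ha x y z).1, (hb x y z).1]; ring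
    · simp only [LinearMap.add_apply, (ha x y z).2, (hb x y z).2]; ring
  smul_mem' := by
    intro c a ha x y z
    refine ⟨?_, ?_⟩
    · simp only [LinearMap.smul_apply, smul_eq_mul, (ha x y z).1]; ring
    · simp only [LinearMap.smul_apply, smul_eq_mul, (ha x y z).2]; ring

/-- `W₁`: the totally skew tensors, `ξ(x; x, z) = 0` (nearly Kähler type). -/
def ghW1 (J : V →ₗ[ℝ] V) : Submodule ℝ (V →ₗ[ℝ] V →ₗ[ℝ] V →ₗ[ℝ] ℝ) where
  carrier := {ξ | ξ ∈ ghSpace J ∧ ∀ x z, ξ x x z = 0}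
  zero_mem' := ⟨zero_mem _, by simp⟩
  add_mem' := by
    rintro a b ⟨ha, ha'⟩ ⟨hb, hb'⟩
    exact ⟨add_mem ha hb, fun x z => by simp [ha' x z, hb' x z]⟩
  smul_mem' := by
    rintro c a ⟨ha, ha'⟩
    exact ⟨Submodule.smul_mem _ c ha, fun x z => by simp [ha' x z]⟩

/-- `W₂`: the tensors with vanishing cyclic sum (almost Kähler type). -/
def ghW2 (J : V →ₗ[ℝ] V) : Submodule ℝ (V →ₗ[ℝ] V →ₗ[ℝ] V →ₗ[ℝ] ℝ) where
  carrier := {ξ | ξ ∈ ghSpace J ∧ ∀ x y z, ξ x y z + ξ y z x + ξ z x y = 0}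
  zero_mem' := ⟨zero_mem _, by simp⟩
  add_mem' := by
    rintro a b ⟨ha, ha'⟩ ⟨hb, hb'⟩
    refine ⟨add_mem ha hb, fun x y z => ?_⟩
    simp only [LinearMap.add_apply]
    linear_combination ha' x y z + hb' x y z
  smul_mem' := by
    rintro c a ⟨ha, ha'⟩
    refine ⟨Submodule.smul_mem _ c ha, fun x y z => ?_⟩
    simp only [LinearMap.smul_apply, smul_eq_mul]
    linear_combination c * ha' x y z

/-- `W₃`: the tensors with `ξ(Jx; Jy, z) = ξ(x; y, z)` and vanishing trace `∑ᵢ ξ(eᵢ; eᵢ, z) = 0`,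
`(eᵢ)` being orthonormal for `g` (integrable and semi-Kähler type). -/
def ghW3 (g : V →ₗ[ℝ] V →ₗ[ℝ] ℝ) (J : V →ₗ[ℝ] V) :
    Submodule ℝ (V →ₗ[ℝ] V →ₗ[ℝ] V →ₗ[ℝ] ℝ) where
  carrier := {ξ | ξ ∈ ghSpace J ∧ (∀ x y z, ξ (J x) (J y) z = ξ x y z) ∧
    ∀ e : Module.Basis (Fin (Module.finrank ℝ V)) ℝ V,
      (∀ i j, g (e i) (e j) = if i = j then 1 else 0) → ∀ z, ∑ i, ξ (e i) (e i) z = 0}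
  zero_mem' := ⟨zero_mem _, by simp, by simp⟩
  add_mem' := by
    rintro a b ⟨ha, ha', ha''⟩ ⟨hb, hb', hb''⟩
    refine ⟨add_mem ha hb, fun x y z => by simp [ha' x y z, hb' x y z], fun e he z => ?_⟩
    simp [Finset.sum_add_distrib, ha'' e he z, hb'' e he z]
  smul_mem' := by
    rintro c a ⟨ha, ha', ha''⟩
    refine ⟨Submodule.smul_mem _ c ha, fun x y z => by simp [ha' x y z], fun e he z => ?_⟩
    simp [← Finset.mul_sum, ha'' e he z]

/-- `W₄` (locally conformal Kähler type): the tensors that are determined by a one-form `θ` through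
`ξ(x; y, z) = g(x, y) θ(z) - g(x, z) θ(y) - g(x, Jy) θ(Jz) + g(x, Jz) θ(Jy)`. -/
def ghW4 (g : V →ₗ[ℝ] V →ₗ[ℝ] ℝ) (J : V →ₗ[ℝ] V) :
    Submodule ℝ (V →ₗ[ℝ] V →ₗ[ℝ] V →ₗ[ℝ] ℝ) where
  carrier := {ξ | ∃ θ : V →ₗ[ℝ] ℝ, ∀ x y z, ξ x y z =
    g x y * θ z - g x z * θ y - g x (J y) * θ (J z) + g x (J z) * θ (J y)}
  zero_mem' := ⟨0, by simp⟩
  add_mem' := by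
    rintro a b ⟨θ, ha⟩ ⟨η, hb⟩
    refine ⟨θ + η, fun x y z => ?_⟩
    simp only [LinearMap.add_apply, ha, hb]; ring
  smul_mem' := by
    rintro c a ⟨θ, ha⟩
    refine ⟨c • θ, fun x y z => ?_⟩
    simp only [LinearMap.smul_apply, smul_eq_mul, ha]; ring

/-- The modules `W₁, W₂, W₃, W₄`, indexed by `1, 2, 3, 4`. -/
def ghW (g : V →ₗ[ℝ] V →ₗ[ℝ] ℝ) (J : V →ₗ[ℝ] V) :
    ℕ → Submodule ℝ (V →ₗ[ℝ] V →ₗ[ℝ] V →ₗ[ℝ] ℝ)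
  | 1 => ghW1 J
  | 2 => ghW2 J
  | 3 => ghW3 g J
  | 4 => ghW4 g J
  | _ => ⊥

/-- The Gray–Hervella class `∑_{i ∈ s} Wᵢ`. -/
def ghClass (g : V →ₗ[ℝ] V →ₗ[ℝ] ℝ) (J : V →ₗ[ℝ] V) (s : Finset ℕ) :
    Submodule ℝ (V →ₗ[ℝ] V →ₗ[ℝ] V →ₗ[ℝ] ℝ) :=
  ⨆ i ∈ s, ghW g J i

end GrayHervella

section Manifold

variable {E : Type*} [NormedAddCommGroup E] [NormedSpace ℝ E]
  {M : Type*} [TopologicalSpace M] [ChartedSpace E M]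

/-- A (not necessarily continuous) field of bilinear forms on the tangent spaces of `M`. -/
abbrev FormField (E : Type*) [NormedAddCommGroup E] [NormedSpace ℝ E]
    (M : Type*) [TopologicalSpace M] [ChartedSpace E M] :=
  ∀ x : M, TangentSpace 𝓘(ℝ, E) x →ₗ[ℝ] TangentSpace 𝓘(ℝ, E) x →ₗ[ℝ] ℝ

/-- A (not necessarily continuous) field of endomorphisms of the tangent spaces of `M`. -/
abbrev EndField (E : Type*) [NormedAddCommGroup E] [NormedSpace ℝ E]
    (M : Type*) [TopologicalSpace M] [ChartedSpace E M] :=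
  ∀ x : M, TangentSpace 𝓘(ℝ, E) x →L[ℝ] TangentSpace 𝓘(ℝ, E) x

/-- An operation `∇` on vector fields; `nabla Y x v` stands for `(∇_v Y)(x)`. -/
abbrev Connection (E : Type*) [NormedAddCommGroup E] [NormedSpace ℝ E]
    (M : Type*) [TopologicalSpace M] [ChartedSpace E M] :=
  (∀ x : M, TangentSpace 𝓘(ℝ, E) x) →
    ∀ x : M, TangentSpace 𝓘(ℝ, E) x →L[ℝ] TangentSpace 𝓘(ℝ, E) x

variable [IsManifold 𝓘(ℝ, E) ∞ M]

/-- The vector field `Y` is differentiable at `x`. -/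
def DiffAt (Y : ∀ x : M, TangentSpace 𝓘(ℝ, E) x) (x : M) : Prop :=
  MDifferentiableAt 𝓘(ℝ, E) 𝓘(ℝ, E).tangent
    (fun y => (⟨y, Y y⟩ : TangentBundle 𝓘(ℝ, E) M)) x

/-- The endomorphism field `A` is smooth, as a section of `End(TM)`. -/
def SmoothEnd (A : EndField E M) : Prop :=
  ContMDiff 𝓘(ℝ, E) (𝓘(ℝ, E).prod 𝓘(ℝ, E →L[ℝ] E)) ∞
    (fun x => TotalSpace.mk' (E →L[ℝ] E)
      (E := fun x : M => TangentSpace 𝓘(ℝ, E) x →L[ℝ] TangentSpace 𝓘(ℝ, E) x) x (A x))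

/-- `nabla` is the Levi-Civita connection of the metric `g` over the (open) set `U`: it is a
covariant derivative, torsion free and compatible with `g` at the points of `U`. -/
structure IsLeviCivitaOn (g : FormField E M) (nabla : Connection E M) (U : Set M) : Prop where
  isCovariantDerivativeOn : IsCovariantDerivativeOn (I := 𝓘(ℝ, E)) E nabla U
  torsion_free : ∀ x ∈ U, ∀ X Y : (∀ x : M, TangentSpace 𝓘(ℝ, E) x), DiffAt X x → DiffAt Y x →
    nabla Y x (X x) - nabla X x (Y x) = VectorField.mlieBracket 𝓘(ℝ, E) X Y x
  metric : ∀ x ∈ U, ∀ Y Z : (∀ x : M, TangentSpace 𝓘(ℝ, E) x), DiffAt Y x → DiffAt Z x →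
    ∀ v, mvfderiv 𝓘(ℝ, E) (fun y => g y (Y y) (Z y)) x v =
      g x (nabla Y x v) (Z x) + g x (Y x) (nabla Z x v)

/-- The Kähler form `ω_A(X, Y) = g(X, AY)`. -/
def kahlerForm (g : FormField E M) (A : EndField E M) : FormField E M :=
  fun x => (g x).compl₂ (A x).toLinearMap

/-- The trilinear form `ξ` on `T_x M` is the value at `x` of the covariant derivative of `om`:
`ξ(v; Y, Z) = v(om(Y, Z)) - om(∇_v Y, Z) - om(Y, ∇_v Z)`. -/
def IsCovDerivAt (nabla : Connection E M) (om : FormField E M) (x : M)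
    (ξ : TangentSpace 𝓘(ℝ, E) x →ₗ[ℝ] TangentSpace 𝓘(ℝ, E) x →ₗ[ℝ]
      TangentSpace 𝓘(ℝ, E) x →ₗ[ℝ] ℝ) : Prop :=
  ∀ Y Z : (∀ x : M, TangentSpace 𝓘(ℝ, E) x), DiffAt Y x → DiffAt Z x → ∀ v,
    ξ v (Y x) (Z x) = mvfderiv 𝓘(ℝ, E) (fun y => om y (Y y) (Z y)) x v
      - om x (nabla Y x v) (Z x) - om x (Y x) (nabla Z x v)

/-- `∇ω_A ∈ ∑_{i ∈ s} Wᵢ`, the modules being those of the almost Hermitian structure `(g, A)`. -/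
def NablaOmegaMem (g : FormField E M) (nabla : Connection E M) (A : EndField E M)
    (s : Finset ℕ) : Prop :=
  ∀ x : M, ∃ ξ ∈ ghClass (g x) (A x).toLinearMap s,
    IsCovDerivAt nabla (kahlerForm g A) x ξ

variable (E M) in
/-- An almost hyper-Hermitian structure on `M`: a smooth Riemannian metric `g` and smooth
orthogonal almost complex structures `I`, `J` that anticommute; the third one is `K = IJ`. -/
structure AlmostHyperHermitian where
  /-- the Riemannian metric -/
  metric : ContMDiffRiemannianMetric 𝓘(ℝ, E) ∞ E (fun x : M => TangentSpace 𝓘(ℝ, E) x)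
  /-- the first almost complex structure -/
  I : EndField E M
  /-- the second almost complex structure -/
  J : EndField E M
  smooth_I : SmoothEnd I
  smooth_J : SmoothEnd J
  I_sq : ∀ x v, I x (I x v) = -v
  J_sq : ∀ x v, J x (J x v) = -v
  anticomm : ∀ x v, I x (J x v) = -J x (I x v)
  orthogonal_I : ∀ x v w, metric.inner x (I x v) (I x w) = metric.inner x v w
  orthogonal_J : ∀ x v w, metric.inner x (J x v) (J x w) = metric.inner x v w

namespace AlmostHyperHermitian

variable (S : AlmostHyperHermitian E M)

/-- The metric, as a field of bilinear forms. -/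
def g : FormField E M := fun x =>
  LinearMap.mk₂ ℝ (fun v w => S.metric.inner x v w) (by simp) (by simp) (by simp) (by simp)

/-- The third almost complex structure `K = IJ`. -/
def K : EndField E M := fun x => (S.I x).comp (S.J x)

/-- For a metric `h` conformal to `g`: `(h, I, J, K)` is hyperKähler over the open set `U`, i.e.
the three Kähler forms are parallel for the Levi-Civita connection of `h` over `U`. -/
def IsHyperKahlerOn (h : FormField E M) (U : Set M) : Prop :=
  ∃ nabla : Connection E M, IsLeviCivitaOn h nabla U ∧ ∀ x ∈ U,
    IsCovDerivAt nabla (kahlerForm h S.I) x 0 ∧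
    IsCovDerivAt nabla (kahlerForm h S.J) x 0 ∧
    IsCovDerivAt nabla (kahlerForm h S.K) x 0

/-- `M` is locally conformal hyperKähler: around every point there are an open set `U` and a
smooth function `f` on `U` such that `e^f g` with `I`, `J`, `K` is hyperKähler over `U`. -/
def IsLocallyConformalHyperKahler : Prop :=
  ∀ p : M, ∃ U : Set M, IsOpen U ∧ p ∈ U ∧ ∃ f : M → ℝ,
    ContMDiffOn 𝓘(ℝ, E) 𝓘(ℝ, ℝ) ∞ f U ∧
    S.IsHyperKahlerOn (fun x => Real.exp (f x) • S.g x) U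

end AlmostHyperHermitian

end Manifold

end HyperHermitian

end

noncomputable section

set_option maxSynthPendingDepth 3
set_option linter.unusedSimpArgs false

/-! Write the complexified tangent space as E ⊗ H. The two-forms transverse to sp(n) are three
copies of Λ²E, the symmetric forms invariant under the unit quaternions. So the covariant
derivatives α, β, γ of the Kähler forms of I, J, K are encoded by three tensors p, q, r in T* ⊗ Λ²E,
with α(x; y, z) = r(x; y, Jz) - q(x; y, Kz) and its cyclic analogues (`exists_components`). For an
infinitesimal conformal change along φ, these are the symmetrizations `symTensor` of g ⊗ (φ∘I), g ⊗
(φ∘J), g ⊗ (φ∘K).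

In these terms the Gray–Hervella classes become linear conditions. If α lies in W₃ + W₄ then q(x) =
r(Ix); if it lies in W₁ + W₂ then q(x) = -r(Ix); a W₄ summand shifts the components by conformal
ones. On the part with q(x) = -r(Ix), being of type W₁ or W₂ puts the remaining tensor in H ⊗ Λ³E or
in H ⊗ ker(E ⊗ Λ²E → Λ³E). These two spaces are the same for I, J and K and meet only in 0
(`QSym.eq_zero_of_hasType`). For n ≥ 2 neither contains a nonzero `symTensor`
(`eq_zero_of_hasType_twist_symTensor`), so the one-forms coming from different structures must
coincide. Each of the five hypotheses then reduces to a small linear system whose only solutions are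
conformal triples (`exists_confForm`).

Globally, torsion-freeness turns this into dω_I = -4 φ ∧ ω_I. In real dimension above four, wedging
with ω_I is injective on one-forms, so φ is smooth, and on two-forms, so d² = 0 gives dφ = 0
(`exists_primitive`). A local f with df = 4φ (`exists_potential`) makes all three Kähler forms of
e^f g parallel (`isHyperKahlerOn_of_isConformalAt`). -/

namespace HyperHermitian

/-! ### Quaternion-invariant tensors and the disjointness of the types W₁ and W₂. -/

section QuaternionicAlgebra

variable {V : Type*} [AddCommGroup V] [Module ℝ V]

/-- `I, J, K` satisfy the quaternion relations. -/
structure IsQuaternionic (I J K : V →ₗ[ℝ] V) : Prop where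
  II : ∀ v, I (I v) = -v
  JJ : ∀ v, J (J v) = -v
  KK : ∀ v, K (K v) = -v
  IJ : ∀ v, I (J v) = K v
  JK : ∀ v, J (K v) = I v
  KI : ∀ v, K (I v) = J v
  JI : ∀ v, J (I v) = -K v
  KJ : ∀ v, K (J v) = -I v
  IK : ∀ v, I (K v) = -J v

lemma IsQuaternionic.cyc {I J K : V →ₗ[ℝ] V} (h : IsQuaternionic I J K) :
    IsQuaternionic J K I :=
  ⟨h.JJ, h.KK, h.II, h.JK, h.KI, h.IJ, h.KJ, h.IK, h.JI⟩

/-- The forms `p(x; ·, ·)` are symmetric and invariant under the unit quaternions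
(only homogeneity with respect to signs is recorded). -/
structure QSym (I J K : V →ₗ[ℝ] V) (p : V → V → V → ℝ) : Prop where
  neg_left : ∀ x y z, p (-x) y z = -p x y z
  neg_right : ∀ x y z, p x y (-z) = -p x y z
  symm : ∀ x y z, p x y z = p x z y
  moveI : ∀ x y z, p x (I y) z = -p x y (I z)
  moveJ : ∀ x y z, p x (J y) z = -p x y (J z)
  moveK : ∀ x y z, p x (K y) z = -p x y (K z)

namespace QSym

variable {I J K : V →ₗ[ℝ] V} {p q : V → V → V → ℝ}

lemma cyc (h : QSym I J K p) : QSym J K I p :=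
  ⟨h.neg_left, h.neg_right, h.symm, h.moveJ, h.moveK, h.moveI⟩

lemma swap (h : QSym I J K p) (y z : V) :
    (∀ a, p a z y = p a y z) ∧ (∀ a, p a z (I y) = -p a y (I z)) ∧
    (∀ a, p a z (J y) = -p a y (J z)) ∧ (∀ a, p a z (K y) = -p a y (K z)) :=
  ⟨fun a => h.symm _ _ _, fun a => by rw [h.symm, h.moveI], fun a => by rw [h.symm, h.moveJ],
    fun a => by rw [h.symm, h.moveK]⟩

lemma sub (hp : QSym I J K p) (hq : QSym I J K q) : QSym I J K (p - q) where
  neg_left x y z := by simp only [Pi.sub_apply, hp.neg_left, hq.neg_left]; ring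
  neg_right x y z := by simp only [Pi.sub_apply, hp.neg_right, hq.neg_right]; ring
  symm x y z := by simp only [Pi.sub_apply, hp.symm x y z, hq.symm x y z]
  moveI x y z := by simp only [Pi.sub_apply, hp.moveI x y z, hq.moveI x y z]; ring
  moveJ x y z := by simp only [Pi.sub_apply, hp.moveJ x y z, hq.moveJ x y z]; ring
  moveK x y z := by simp only [Pi.sub_apply, hp.moveK x y z, hq.moveK x y z]; ring

end QSym

/-- The trilinear form `ξ(x; y, z)` is skew in its first two arguments. -/
def IsSkew (f : V → V → V → ℝ) : Prop := ∀ x y z, f x y z + f y x z = 0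

/-- The cyclic sums of the trilinear form `ξ(x; y, z)` vanish. -/
def IsCyclic (f : V → V → V → ℝ) : Prop := ∀ x y z, f x y z + f y z x + f z x y = 0

/-- The defining symmetry of `W₁` (for `i = 1`) and of `W₂` (for `i = 2`). -/
def HasType (i : ℕ) (f : V → V → V → ℝ) : Prop :=
  (i = 1 ∧ IsSkew f) ∨ (i = 2 ∧ IsCyclic f)

/-- The tensor in `W₁ + W₂` of the first structure that is determined by `r`. -/
def twist (A B C : V →ₗ[ℝ] V) (r : V → V → V → ℝ) (x y z : V) : ℝ :=
  r x y (B z) + r (A x) y (C z)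

lemma HasType.smul {W : Type*} {i : ℕ} {f g : W → W → W → ℝ} (h : HasType i f) (c : ℝ)
    (hg : ∀ x y z, g x y z = c * f x y z) : HasType i g := by
  rcases h with ⟨hi, h⟩ | ⟨hi, h⟩
  · exact Or.inl ⟨hi, fun x y z => by rw [hg, hg, ← mul_add, h, mul_zero]⟩
  · exact Or.inr ⟨hi, fun x y z => by rw [hg, hg, hg, ← mul_add, ← mul_add, h, mul_zero]⟩

section Core

variable {I J K : V →ₗ[ℝ] V} {p : V → V → V → ℝ}

/-- View p in H ⊗ (E ⊗ Λ²E). Precomposing the first argument with J acts on H alone, and `twist`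
leaves the E ⊗ Λ²E factor untouched. So the skewness hypothesis, though stated for I, places p in H
⊗ Λ³E, and the cyclicity hypothesis, stated for J, places it in H ⊗ ker(E ⊗ Λ²E → Λ³E). The six
instances are an explicit elimination expressing that these spaces meet in 0. -/
lemma QSym.eq_zero_of_skew_of_cyclic (hQ : IsQuaternionic I J K) (hp : QSym I J K p)
    (h1 : IsSkew (twist I J K fun x y z => p (J x) y z)) (h2 : IsCyclic (twist J K I p))
    (x y z : V) : p x y z = 0 := by
  obtain ⟨a1, a2, a3, a4⟩ := hp.swap y z
  obtain ⟨b1, b2, b3, b4⟩ := hp.swap x y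
  obtain ⟨c1, c2, c3, c4⟩ := hp.swap x z
  have e1 := h1 (K x) y (K z)
  have e2 := h1 (I y) (K z) (J x)
  have e3 := h1 (I z) (K x) (J y)
  have e4 := h2 x (K y) z
  have e5 := h2 x (J y) (I z)
  have e6 := h1 (K y) (I z) (J x)
  simp only [twist, hQ.II, hQ.JJ, hQ.KK, hQ.IJ, hQ.JK, hQ.KI, hQ.JI, hQ.KJ, hQ.IK, map_neg,
    hp.neg_left, hp.neg_right, hp.moveI, hp.moveJ, hp.moveK, neg_neg,
    a1, a2, a3, a4, b1, b2, b3, b4, c1, c2, c3, c4] at e1 e2 e3 e4 e5 e6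
  linarith

/-- The same two complementary subspaces, with the roles of I and J exchanged. -/
lemma QSym.eq_zero_of_cyclic_of_skew (hQ : IsQuaternionic I J K) (hp : QSym I J K p)
    (h1 : IsCyclic (twist I J K fun x y z => p (J x) y z)) (h2 : IsSkew (twist J K I p))
    (x y z : V) : p x y z = 0 := by
  obtain ⟨a1, a2, a3, a4⟩ := hp.swap y z
  obtain ⟨b1, b2, b3, b4⟩ := hp.swap x y
  obtain ⟨c1, c2, c3, c4⟩ := hp.swap x z
  have e1 := h2 (K z) (J x) (J y)
  have e2 := h2 (J x) (K y) (J z)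
  have e3 := h1 (J x) y (J z)
  have e4 := h1 (K x) (K y) z
  have e5 := h2 y (I z) (J x)
  have e6 := h2 (K y) (J z) (J x)
  simp only [twist, hQ.II, hQ.JJ, hQ.KK, hQ.IJ, hQ.JK, hQ.KI, hQ.JI, hQ.KJ, hQ.IK, map_neg,
    hp.neg_left, hp.neg_right, hp.moveI, hp.moveJ, hp.moveK, neg_neg,
    a1, a2, a3, a4, b1, b2, b3, b4, c1, c2, c3, c4] at e1 e2 e3 e4 e5 e6
  linarith

lemma QSym.eq_zero_of_hasType {i j : ℕ} (hQ : IsQuaternionic I J K) (hp : QSym I J K p)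
    (hij : i ≠ j) (h1 : HasType i (twist I J K fun x y z => p (J x) y z))
    (h2 : HasType j (twist J K I p)) : p = 0 := by
  funext x y z
  rcases h1 with ⟨rfl, h1⟩ | ⟨rfl, h1⟩ <;> rcases h2 with ⟨rfl, h2⟩ | ⟨rfl, h2⟩
  · exact absurd rfl hij
  · exact hp.eq_zero_of_skew_of_cyclic hQ h1 h2 x y z
  · exact hp.eq_zero_of_cyclic_of_skew hQ h1 h2 x y z
  · exact absurd rfl hij

end Core

/-! ### The components of a conformal change. -/

/-- `g` is an inner product for which the quaternionic structures `I, J, K` are skew. -/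
structure IsHermitianFrame (g : V →ₗ[ℝ] V →ₗ[ℝ] ℝ) (I J K : V →ₗ[ℝ] V) : Prop where
  quat : IsQuaternionic I J K
  symm : ∀ x y, g x y = g y x
  pos : ∀ x, x ≠ 0 → 0 < g x x
  skewI : ∀ x y, g (I x) y = -g x (I y)
  skewJ : ∀ x y, g (J x) y = -g x (J y)
  skewK : ∀ x y, g (K x) y = -g x (K y)

/-- The quaternionic-Hermitian symmetrization of `g(x, y) φ(z)`. -/
def symTensor (g : V →ₗ[ℝ] V →ₗ[ℝ] ℝ) (I J K : V →ₗ[ℝ] V) (φ : V →ₗ[ℝ] ℝ) (x y z : V) : ℝ :=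
  g x y * φ z + g x z * φ y + g x (I y) * φ (I z) + g x (I z) * φ (I y)
    + g x (J y) * φ (J z) + g x (J z) * φ (J y) + g x (K y) * φ (K z) + g x (K z) * φ (K y)

/-- The value on the Kähler form of `A` of the infinitesimal conformal change along `φ`. -/
def confForm (g : V →ₗ[ℝ] V →ₗ[ℝ] ℝ) (A : V →ₗ[ℝ] V) (φ : V →ₗ[ℝ] ℝ) (x y z : V) : ℝ :=
  -2 * (g x y * φ (A z) - g x z * φ (A y) + g x (A y) * φ z - g x (A z) * φ y)

section Frame

variable {g : V →ₗ[ℝ] V →ₗ[ℝ] ℝ} {I J K : V →ₗ[ℝ] V}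

lemma IsHermitianFrame.cyc (h : IsHermitianFrame g I J K) : IsHermitianFrame g J K I :=
  ⟨h.quat.cyc, h.symm, h.pos, h.skewJ, h.skewK, h.skewI⟩

lemma IsHermitianFrame.apply_I_self (h : IsHermitianFrame g I J K) (x : V) : g x (I x) = 0 := by
  have h1 := h.skewI x x
  have h2 := h.symm x (I x)
  linarith

lemma symTensor_cyc (φ : V →ₗ[ℝ] ℝ) : symTensor g J K I φ = symTensor g I J K φ := by
  funext x y z; simp only [symTensor]; ring

lemma symTensor_qSym (h : IsHermitianFrame g I J K) (φ : V →ₗ[ℝ] ℝ) :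
    QSym I J K (symTensor g I J K φ) := by
  constructor <;> intro x y z <;>
    simp only [symTensor, h.quat.II, h.quat.JJ, h.quat.KK, h.quat.IJ, h.quat.JK, h.quat.KI,
      h.quat.JI, h.quat.KJ, h.quat.IK, map_neg, LinearMap.neg_apply] <;> ring

/-- This identifies the components of a conformal change: r comes from φ∘K and q from φ∘J, hence p
from φ∘I by cyclic symmetry. -/
lemma confForm_eq (h : IsHermitianFrame g I J K) (φ : V →ₗ[ℝ] ℝ) (x y z : V) :
    confForm g I φ x y z = symTensor g I J K (φ ∘ₗ K) x y (J z)
      - symTensor g I J K (φ ∘ₗ J) x y (K z) := by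
  simp only [symTensor, confForm, h.quat.II, h.quat.JJ, h.quat.KK, h.quat.IJ, h.quat.JK, h.quat.KI,
    h.quat.JI, h.quat.KJ, h.quat.IK, map_neg, LinearMap.comp_apply]
  ring

/-- In dimension at least five there is a nonzero vector orthogonal to four given ones. -/
lemma exists_orthogonal (g : V →ₗ[ℝ] V →ₗ[ℝ] ℝ) (hV : 4 < Module.finrank ℝ V) (a b c d : V) :
    ∃ v : V, v ≠ 0 ∧ g a v = 0 ∧ g b v = 0 ∧ g c v = 0 ∧ g d v = 0 := by
  have : FiniteDimensional ℝ V := Module.finite_of_finrank_pos (by omega)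
  obtain ⟨v, hv, hne⟩ := (Submodule.ne_bot_iff _).1
    (LinearMap.ker_ne_bot_of_finrank_lt
      (f := LinearMap.pi (R := ℝ) (φ := fun _ : Fin 4 => ℝ) ![g a, g b, g c, g d]) (by simpa using hV))
  have hv' := fun i => congrFun (LinearMap.mem_ker.1 hv) i
  exact ⟨v, hne, by simpa using hv' 0, by simpa using hv' 1, by simpa using hv' 2,
    by simpa using hv' 3⟩

lemma eq_zero_of_isSkew_twist_symTensor (h : IsHermitianFrame g I J K) {φ : V →ₗ[ℝ] ℝ}
    (hs : IsSkew (twist I J K (symTensor g I J K φ))) : φ = 0 := by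
  ext x
  rcases eq_or_ne x 0 with rfl | hx
  · simp
  have e := hs x x (J x)
  simp only [twist, symTensor, h.quat.II, h.quat.JJ, h.quat.KK, h.quat.IJ, h.quat.JK, h.quat.KI,
    h.quat.JI, h.quat.KJ, h.quat.IK, map_neg, h.skewI, h.apply_I_self, h.cyc.apply_I_self,
    h.cyc.cyc.apply_I_self] at e
  have : g x x * φ x = 0 := by linarith
  simpa [(h.pos x hx).ne'] using this

/-- The dimension matters: if dim E = 2 then Λ³E = 0 and cyclicity is no condition at all. With a
vector u orthogonal to the quaternionic line of v, the cyclic sum at (u, Ju, v) retains only a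
multiple of g(u, u) φ(v). -/
lemma eq_zero_of_isCyclic_twist_symTensor (h : IsHermitianFrame g I J K)
    (hV : 4 < Module.finrank ℝ V) {φ : V →ₗ[ℝ] ℝ}
    (hs : IsCyclic (twist I J K (symTensor g I J K φ))) : φ = 0 := by
  ext v
  obtain ⟨u, hu, o1, o2, o3, o4⟩ := exists_orthogonal g hV v (I v) (J v) (K v)
  rw [h.skewI, neg_eq_zero] at o2
  rw [h.skewJ, neg_eq_zero] at o3
  rw [h.skewK, neg_eq_zero] at o4
  have s0 : g u v = 0 := by rw [h.symm, o1]
  have s1 : g u (I v) = 0 := by rw [h.symm, h.skewI, o2, neg_zero]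
  have s2 : g u (J v) = 0 := by rw [h.symm, h.skewJ, o3, neg_zero]
  have s3 : g u (K v) = 0 := by rw [h.symm, h.skewK, o4, neg_zero]
  have e := hs u (J u) v
  simp only [twist, symTensor, h.quat.II, h.quat.JJ, h.quat.KK, h.quat.IJ, h.quat.JK, h.quat.KI,
    h.quat.JI, h.quat.KJ, h.quat.IK, map_neg, h.skewI, h.skewJ, h.skewK, h.apply_I_self,
    h.cyc.apply_I_self, h.cyc.cyc.apply_I_self, o1, o2, o3, o4, s0, s1, s2, s3] at e
  have : g u u * φ v = 0 := by linarith
  simpa [(h.pos u hu).ne'] using this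

lemma eq_zero_of_hasType_twist_symTensor (h : IsHermitianFrame g I J K)
    (hV : 4 < Module.finrank ℝ V) {i : ℕ} {φ : V →ₗ[ℝ] ℝ}
    (hs : HasType i (twist I J K (symTensor g I J K φ))) : φ = 0 := by
  rcases hs with ⟨-, hs⟩ | ⟨-, hs⟩
  · exact eq_zero_of_isSkew_twist_symTensor h hs
  · exact eq_zero_of_isCyclic_twist_symTensor h hV hs

end Frame

end QuaternionicAlgebra

/-! ### Gray–Hervella classes as linear conditions on the components. -/

section GrayHervellaClasses

variable {V : Type*} [AddCommGroup V] [Module ℝ V]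
  {g : V →ₗ[ℝ] V →ₗ[ℝ] ℝ} {I J K : V →ₗ[ℝ] V} {p q r : V → V → V → ℝ}

lemma QSym.comp (hp : QSym I J K p) (A : V →ₗ[ℝ] V) :
    QSym I J K (fun x y z => p (A x) y z) where
  neg_left x y z := by rw [map_neg, hp.neg_left]
  neg_right x y z := hp.neg_right _ y z
  symm x y z := hp.symm _ y z
  moveI x y z := hp.moveI _ y z
  moveJ x y z := hp.moveJ _ y z
  moveK x y z := hp.moveK _ y z

/-- Substituting Ax for x in the symmetrization has the same effect as replacing the one-form by its
composition with A; the six identities are the quaternion multiplication table. -/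
lemma symTensor_comp_apply (h : IsHermitianFrame g I J K) (φ : V →ₗ[ℝ] ℝ) (x y z : V) :
    symTensor g I J K (φ ∘ₗ I) (J x) y z = symTensor g I J K (φ ∘ₗ K) x y z ∧
    symTensor g I J K (φ ∘ₗ J) (K x) y z = symTensor g I J K (φ ∘ₗ I) x y z ∧
    symTensor g I J K (φ ∘ₗ K) (I x) y z = symTensor g I J K (φ ∘ₗ J) x y z ∧
    symTensor g I J K (φ ∘ₗ J) (I x) y z = -symTensor g I J K (φ ∘ₗ K) x y z ∧
    symTensor g I J K (φ ∘ₗ K) (J x) y z = -symTensor g I J K (φ ∘ₗ I) x y z ∧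
    symTensor g I J K (φ ∘ₗ I) (K x) y z = -symTensor g I J K (φ ∘ₗ J) x y z := by
  refine ⟨?_, ?_, ?_, ?_, ?_, ?_⟩ <;>
  · simp only [symTensor, h.quat.II, h.quat.JJ, h.quat.KK, h.quat.IJ, h.quat.JK, h.quat.KI,
      h.quat.JI, h.quat.KJ, h.quat.IK, map_neg, LinearMap.comp_apply, h.skewI, h.skewJ, h.skewK]
    ring

lemma symTensor_sub_comp (φ ψ : V →ₗ[ℝ] ℝ) (A : V →ₗ[ℝ] V) (x y z : V) :
    symTensor g I J K ((φ - ψ) ∘ₗ A) x y z =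
      symTensor g I J K (φ ∘ₗ A) x y z - symTensor g I J K (ψ ∘ₗ A) x y z := by
  simp only [symTensor, LinearMap.comp_apply, LinearMap.sub_apply]; ring

/-- The tensor `∇ω` of the first structure of a frame, in terms of its two components. -/
def pairTensor (J K : V →ₗ[ℝ] V) (r q : V → V → V → ℝ) (x y z : V) : ℝ :=
  r x y (J z) - q x y (K z)

/-- Put m(x) = q(x) + r(Ix). The hypothesis becomes m(x; y, z) = m(Ix; y, Iz). In the pair (y, z)
the left side is J-invariant and the right side J-anti-invariant, so both vanish; the two instances
extract these two parts. -/
lemma QSym.eq_neg_of_anti (hQ : IsQuaternionic I J K) (hr : QSym I J K r) (hq : QSym I J K q)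
    (h : ∀ x y z, pairTensor J K r q (I x) (I y) z = -pairTensor J K r q x y z) (x y z : V) :
    q x y z = -r (I x) y z := by
  have e1 := h x y (K z)
  have e2 := h x (J y) (I z)
  simp only [pairTensor, hQ.II, hQ.JJ, hQ.KK, hQ.IJ, hQ.JK, hQ.KI, hQ.JI, hQ.KJ, hQ.IK, map_neg,
    hr.neg_left, hr.neg_right, hr.moveI, hr.moveJ, hr.moveK, neg_neg,
    hq.neg_left, hq.neg_right, hq.moveI, hq.moveJ, hq.moveK] at e1 e2
  linarith

/-- The argument for anti-invariance, applied to q(x) - r(Ix). -/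
lemma QSym.eq_of_invariant (hQ : IsQuaternionic I J K) (hr : QSym I J K r) (hq : QSym I J K q)
    (h : ∀ x y z, pairTensor J K r q (I x) (I y) z = pairTensor J K r q x y z) (x y z : V) :
    q x y z = r (I x) y z := by
  have e1 := h x y (K z)
  have e2 := h x (J y) (I z)
  simp only [pairTensor, hQ.II, hQ.JJ, hQ.KK, hQ.IJ, hQ.JK, hQ.KI, hQ.JI, hQ.KJ, hQ.IK, map_neg,
    hr.neg_left, hr.neg_right, hr.moveI, hr.moveJ, hr.moveK, neg_neg,
    hq.neg_left, hq.neg_right, hq.moveI, hq.moveJ, hq.moveK] at e1 e2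
  linarith

lemma QSym.eq_zero_of_pairTensor (hQ : IsQuaternionic I J K) (hr : QSym I J K r)
    (hq : QSym I J K q) (h : ∀ x y z, pairTensor J K r q x y z = 0) : r = 0 ∧ q = 0 := by
  have h1 := hr.eq_neg_of_anti hQ hq (fun x y z => by rw [h, h, neg_zero])
  have h2 := hr.eq_of_invariant hQ hq (fun x y z => by rw [h, h])
  have hq0 : ∀ x y z, q x y z = 0 := fun x y z => by linarith [h1 x y z, h2 x y z]
  refine ⟨funext fun x => funext fun y => funext fun z => ?_, funext fun x => funext fun y =>
    funext fun z => hq0 x y z⟩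
  have h3 := h2 (I x) y z
  rw [hq0, hQ.II, hr.neg_left] at h3
  simp only [Pi.zero_apply]; linarith

section Membership

variable {α ξ : V →ₗ[ℝ] V →ₗ[ℝ] V →ₗ[ℝ] ℝ} {A : V →ₗ[ℝ] V}

lemma ghSpace_move (hA : ∀ v, A (A v) = -v) (h : ξ ∈ ghSpace A) (x y z : V) :
    ξ x (A y) z = ξ x y (A z) := by
  have := (h x y (A z)).2
  rw [hA, map_neg] at this
  linarith

lemma anti_of_mem_ghW1 (h : ξ ∈ ghW1 A) :
    HasType 1 (fun x y z => ξ x y z) ∧ ∀ x y z, ξ (A x) (A y) z = -ξ x y z := by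
  have hs : ∀ x y z, ξ x y z + ξ y x z = 0 := fun x y z => by
    have := h.2 (x + y) z
    simp only [map_add, LinearMap.add_apply, h.2] at this
    linarith
  refine ⟨Or.inl ⟨rfl, hs⟩, fun x y z => ?_⟩
  have e1 := hs (A x) z (A y)
  have e2 := (h.1 (A x) (A y) z).1
  have e3 := (h.1 z x y).2
  have e4 := hs z x y
  have e5 := (h.1 x y z).1
  linarith

lemma anti_of_mem_ghW2 (hA : ∀ v, A (A v) = -v) (h : ξ ∈ ghW2 A) :
    HasType 2 (fun x y z => ξ x y z) ∧ ∀ x y z, ξ (A x) (A y) z = -ξ x y z := by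
  refine ⟨Or.inr ⟨rfl, h.2⟩, fun x y z => ?_⟩
  -- The cyclic identity at (Ax, Ay, z). Its three cyclic versions form a linear system for the
  -- three terms ξ(Ax; Ay, z), whose solution simplifies by the cyclic identity at (x, y, z).
  have key : ∀ x y z, ξ (A x) (A y) z + ξ (A y) (A z) x = ξ z x y := fun x y z => by
    have e1 := h.2 (A x) (A y) z
    have e2 := (h.1 z x y).2
    have e3 := ghSpace_move hA h.1 (A y) z x
    linarith
  have e1 := key x y z
  have e2 := key y z x
  have e3 := key z x y
  have e4 := h.2 x y z
  linarith

lemma anti_of_mem_ghW (hA : ∀ v, A (A v) = -v) {i : ℕ} (hi : i = 1 ∨ i = 2)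
    (h : ξ ∈ ghW g A i) :
    HasType i (fun x y z => ξ x y z) ∧ ∀ x y z, ξ (A x) (A y) z = -ξ x y z := by
  rcases hi with rfl | rfl
  · exact anti_of_mem_ghW1 h
  · exact anti_of_mem_ghW2 hA h

lemma confForm_of_mem_ghW4 (hA : ∀ v, A (A v) = -v) (h : ξ ∈ ghW4 g A) :
    ∃ φ : V →ₗ[ℝ] ℝ, ∀ x y z, ξ x y z = confForm g A φ x y z := by
  obtain ⟨θ, hθ⟩ := h
  -- Since A² = -1, this choice gives -2 φ(Az) = θ(z).
  refine ⟨(1 / 2 : ℝ) • θ ∘ₗ A, fun x y z => ?_⟩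
  simp only [hθ, confForm, LinearMap.smul_apply, LinearMap.comp_apply, hA, map_neg, smul_eq_mul]
  ring

lemma mem_ghClass_pair {i j : ℕ} : α ∈ ghClass g A {i, j} ↔
    ∃ ξ ∈ ghW g A i, ∃ η ∈ ghW g A j, α = ξ + η := by
  simp only [ghClass, Finset.iSup_insert, Finset.iSup_singleton, Submodule.mem_sup, eq_comm]

lemma mem_ghClass_triple {i j k : ℕ} : α ∈ ghClass g A {i, j, k} ↔
    ∃ ξ ∈ ghW g A i, ∃ η ∈ ghW g A j, ∃ ζ ∈ ghW g A k, α = ξ + η + ζ := by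
  simp only [ghClass, Finset.iSup_insert, Finset.iSup_singleton, Submodule.mem_sup]
  constructor
  · rintro ⟨ξ, hξ, _, ⟨η, hη, ζ, hζ, rfl⟩, rfl⟩
    exact ⟨ξ, hξ, η, hη, ζ, hζ, (add_assoc _ _ _).symm⟩
  · rintro ⟨ξ, hξ, η, hη, ζ, hζ, rfl⟩
    exact ⟨ξ, hξ, _, ⟨η, hη, ζ, hζ, rfl⟩, (add_assoc _ _ _).symm⟩

lemma mem_ghClass_four : α ∈ ghClass g A {4} ↔ α ∈ ghW4 g A := by
  simp only [ghClass, Finset.iSup_singleton, ghW]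

lemma ghW_le_ghSpace (hA : ∀ v, A (A v) = -v) (i : ℕ) : ghW g A i ≤ ghSpace A := by
  intro ξ h
  unfold ghW at h
  split at h
  · exact h.1
  · exact h.1
  · exact h.1
  · obtain ⟨θ, hθ⟩ := h
    intro x y z
    simp only [hθ, hA, map_neg]
    constructor <;> ring
  · rw [(Submodule.mem_bot ℝ).1 h]
    exact zero_mem _

lemma ghClass_le_ghSpace (hA : ∀ v, A (A v) = -v) (s : Finset ℕ) :
    ghClass g A s ≤ ghSpace A :=
  iSup₂_le fun i _ => ghW_le_ghSpace hA i

end Membership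

section Components

variable {α : V →ₗ[ℝ] V →ₗ[ℝ] V →ₗ[ℝ] ℝ}

lemma confForm_invariant (h : IsHermitianFrame g I J K) (φ : V →ₗ[ℝ] ℝ) (x y z : V) :
    confForm g I φ (I x) (I y) z = confForm g I φ x y z := by
  simp only [confForm, h.skewI, h.quat.II, map_neg]; ring

lemma pairTensor_sub_symTensor (h : IsHermitianFrame g I J K) (φ : V →ₗ[ℝ] ℝ) (x y z : V) :
    pairTensor J K (r - symTensor g I J K (φ ∘ₗ K)) (q - symTensor g I J K (φ ∘ₗ J)) x y z =
      pairTensor J K r q x y z - confForm g I φ x y z := by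
  rw [confForm_eq h]; simp only [pairTensor, Pi.sub_apply]; ring

lemma components_of_mem_four (h : IsHermitianFrame g I J K) (hr : QSym I J K r)
    (hq : QSym I J K q) (hα : ∀ x y z, α x y z = pairTensor J K r q x y z)
    (hm : α ∈ ghClass g I {4}) : ∃ φ : V →ₗ[ℝ] ℝ,
      r = symTensor g I J K (φ ∘ₗ K) ∧ q = symTensor g I J K (φ ∘ₗ J) := by
  obtain ⟨φ, hφ⟩ := confForm_of_mem_ghW4 h.quat.II (mem_ghClass_four.1 hm)
  refine ⟨φ, ?_⟩
  have := (hr.sub (symTensor_qSym h (φ ∘ₗ K))).eq_zero_of_pairTensor h.quat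
    (hq.sub (symTensor_qSym h (φ ∘ₗ J)))
    (fun x y z => by rw [pairTensor_sub_symTensor h, ← hα, hφ, sub_self])
  exact ⟨sub_eq_zero.1 this.1, sub_eq_zero.1 this.2⟩

/-- Subtracting the conformal components of η leaves a pair representing the anti-invariant ξ, so
the new q is minus the new r precomposed with I. Eliminating it writes ξ as a `twist`; the factor 2
appears because both subtracted terms contribute the same tensor. -/
lemma components_of_anti_add (h : IsHermitianFrame g I J K) (hr : QSym I J K r)
    (hq : QSym I J K q) {ξ η : V →ₗ[ℝ] V →ₗ[ℝ] V →ₗ[ℝ] ℝ}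
    (hα : ∀ x y z, ξ x y z + η x y z = pairTensor J K r q x y z)
    (hξ : ∀ x y z, ξ (I x) (I y) z = -ξ x y z) (hη : η ∈ ghW g I 4) : ∃ φ : V →ₗ[ℝ] ℝ,
      (∀ x y z, q x y z + r (I x) y z = 2 * symTensor g I J K (φ ∘ₗ J) x y z) ∧
      ∀ x y z, twist I J K (r - symTensor g I J K (φ ∘ₗ K)) x y z = ξ x y z := by
  obtain ⟨φ, hφ⟩ := confForm_of_mem_ghW4 h.quat.II hη
  have e : ∀ x y z, pairTensor J K (r - symTensor g I J K (φ ∘ₗ K))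
      (q - symTensor g I J K (φ ∘ₗ J)) x y z = ξ x y z := fun x y z => by
    rw [pairTensor_sub_symTensor h, ← hα, hφ]; ring
  have hm := (hr.sub (symTensor_qSym h (φ ∘ₗ K))).eq_neg_of_anti h.quat
    (hq.sub (symTensor_qSym h (φ ∘ₗ J))) (fun x y z => by rw [e, e, hξ])
  refine ⟨φ, fun x y z => ?_, fun x y z => ?_⟩
  · have e1 := hm x y z
    simp only [Pi.sub_apply, (symTensor_comp_apply h φ x y z).2.2.1] at e1
    linarith
  · rw [← e, twist, pairTensor, hm, sub_neg_eq_add]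

lemma components_of_mem_pair (h : IsHermitianFrame g I J K) (hr : QSym I J K r)
    (hq : QSym I J K q) (hα : ∀ x y z, α x y z = pairTensor J K r q x y z) {i : ℕ}
    (hi : i = 1 ∨ i = 2) (hm : α ∈ ghClass g I {i, 4}) : ∃ φ : V →ₗ[ℝ] ℝ,
      (∀ x y z, q x y z + r (I x) y z = 2 * symTensor g I J K (φ ∘ₗ J) x y z) ∧
      HasType i (twist I J K (r - symTensor g I J K (φ ∘ₗ K))) := by
  obtain ⟨ξ, hξ, η, hη, rfl⟩ := mem_ghClass_pair.1 hm
  obtain ⟨ht, ha⟩ := anti_of_mem_ghW h.quat.II hi hξ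
  obtain ⟨φ, h1, h2⟩ := components_of_anti_add h hr hq hα ha hη
  exact ⟨φ, h1, ht.smul 1 fun x y z => by rw [h2, one_mul]⟩

lemma components_of_mem_one_two_four (h : IsHermitianFrame g I J K) (hr : QSym I J K r)
    (hq : QSym I J K q) (hα : ∀ x y z, α x y z = pairTensor J K r q x y z)
    (hm : α ∈ ghClass g I {1, 2, 4}) : ∃ φ : V →ₗ[ℝ] ℝ,
      ∀ x y z, q x y z + r (I x) y z = 2 * symTensor g I J K (φ ∘ₗ J) x y z := by
  obtain ⟨ξ, hξ, ζ, hζ, η, hη, rfl⟩ := mem_ghClass_triple.1 hm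
  have h1 := (anti_of_mem_ghW h.quat.II (Or.inl rfl) hξ).2
  have h2 := (anti_of_mem_ghW h.quat.II (Or.inr rfl) hζ).2
  obtain ⟨φ, h1, -⟩ := components_of_anti_add h hr hq (ξ := ξ + ζ) hα
    (fun x y z => by simp only [LinearMap.add_apply, h1, h2]; ring) hη
  exact ⟨φ, h1⟩

lemma invariant_of_mem_three_add_four (h : IsHermitianFrame g I J K)
    {ξ η : V →ₗ[ℝ] V →ₗ[ℝ] V →ₗ[ℝ] ℝ} (hξ : ξ ∈ ghW g I 3) (hη : η ∈ ghW g I 4) (x y z : V) :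
    ξ (I x) (I y) z + η (I x) (I y) z = ξ x y z + η x y z := by
  obtain ⟨φ, hφ⟩ := confForm_of_mem_ghW4 h.quat.II hη
  rw [hφ, hφ, confForm_invariant h, hξ.2.1]

lemma components_of_mem_three_four (h : IsHermitianFrame g I J K) (hr : QSym I J K r)
    (hq : QSym I J K q) (hα : ∀ x y z, α x y z = pairTensor J K r q x y z)
    (hm : α ∈ ghClass g I {3, 4}) (x y z : V) : q x y z = r (I x) y z := by
  obtain ⟨ξ, hξ, η, hη, rfl⟩ := mem_ghClass_pair.1 hm
  refine hr.eq_of_invariant h.quat hq (fun x y z => ?_) x y z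
  rw [← hα, ← hα]
  exact invariant_of_mem_three_add_four h hξ hη x y z

/-- The difference α(x; y, z) - α(Ix; Iy, z) kills the invariant part W₃ + W₄ and doubles the Wᵢ
part. In components it is the `twist` of r(x) + q(Ix). -/
lemma components_of_mem_three_four_add (h : IsHermitianFrame g I J K) (hr : QSym I J K r)
    (hq : QSym I J K q) (hα : ∀ x y z, α x y z = pairTensor J K r q x y z) {i : ℕ}
    (hi : i = 1 ∨ i = 2) (hm : α ∈ ghClass g I {i, 3, 4}) :
    HasType i (twist I J K fun x y z => r x y z + q (I x) y z) := by
  obtain ⟨ξ, hξ, ζ, hζ, η, hη, rfl⟩ := mem_ghClass_triple.1 hm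
  obtain ⟨ht, ha⟩ := anti_of_mem_ghW h.quat.II hi hξ
  refine ht.smul 2 fun x y z => ?_
  have e1 := hα x y z
  have e2 := hα (I x) (I y) z
  have e3 := invariant_of_mem_three_add_four h hζ hη x y z
  simp only [LinearMap.add_apply, ha] at e1 e2
  simp only [pairTensor, hr.moveI, hq.moveI, h.quat.IJ, h.quat.IK, hq.neg_right] at e1 e2
  simp only [twist, h.quat.II, hq.neg_left]
  linarith

end Components

end GrayHervellaClasses

/-! ### The pointwise classification: each hypothesis forces a conformal triple. -/

section PointwiseClassification

variable {V : Type*} [AddCommGroup V] [Module ℝ V]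
  {g : V →ₗ[ℝ] V →ₗ[ℝ] ℝ} {I J K : V →ₗ[ℝ] V} {p q r : V → V → V → ℝ}

/-- The components `p, q, r` are those of an infinitesimal conformal change. -/
def IsConformalTriple (g : V →ₗ[ℝ] V →ₗ[ℝ] ℝ) (I J K : V →ₗ[ℝ] V) (p q r : V → V → V → ℝ) : Prop :=
  ∃ φ : V →ₗ[ℝ] ℝ, (∀ x y z, p x y z = symTensor g I J K (φ ∘ₗ I) x y z) ∧
    (∀ x y z, q x y z = symTensor g I J K (φ ∘ₗ J) x y z) ∧
    ∀ x y z, r x y z = symTensor g I J K (φ ∘ₗ K) x y z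

lemma comp_eq_zero {A : V →ₗ[ℝ] V} (hA : ∀ v, A (A v) = -v) {φ : V →ₗ[ℝ] ℝ} (h : φ ∘ₗ A = 0) :
    φ = 0 := by
  ext v
  have := LinearMap.congr_fun h (A v)
  simpa [hA] using this

/-- This is how one-forms attached to different structures are matched: the `symTensor` of their
difference would be of pure type W₁ or W₂, which is impossible unless it vanishes. -/
lemma eq_of_hasType (h : IsHermitianFrame g I J K) (hV : 4 < Module.finrank ℝ V) {i : ℕ}
    {φ ψ : V →ₗ[ℝ] ℝ} {A : V →ₗ[ℝ] V} (hA : ∀ v, A (A v) = -v) {f : V → V → V → ℝ}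
    {c : ℝ} (hc : c ≠ 0)
    (hf : ∀ x y z, f x y z =
      c * (symTensor g I J K (φ ∘ₗ A) x y z - symTensor g I J K (ψ ∘ₗ A) x y z))
    (ht : HasType i (twist I J K f)) : φ = ψ := by
  refine sub_eq_zero.1 (comp_eq_zero hA (eq_zero_of_hasType_twist_symTensor h hV (i := i)
    (ht.smul c⁻¹ fun x y z => ?_)))
  simp only [twist, hf, symTensor_sub_comp]
  field_simp

/-- The three relations `hI`, `hJ`, `hK` determine p, q, r as combinations of symmetrizations in φ₀,
φ, ψ. The types `hIi` and `hJj` then force the three one-forms to agree. -/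
lemma conformal_of_anti (h : IsHermitianFrame g I J K) (hV : 4 < Module.finrank ℝ V)
    (hr : QSym I J K r) {i j : ℕ} {φ₀ φ ψ : V →ₗ[ℝ] ℝ}
    (hI : ∀ x y z, q x y z + r (I x) y z = 2 * symTensor g I J K (φ₀ ∘ₗ J) x y z)
    (hIi : HasType i (twist I J K (r - symTensor g I J K (φ₀ ∘ₗ K))))
    (hp : QSym I J K p)
    (hJ : ∀ x y z, r x y z + p (J x) y z = 2 * symTensor g I J K (φ ∘ₗ K) x y z)
    (hJj : HasType j (twist J K I (p - symTensor g I J K (φ ∘ₗ I))))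
    (hK : ∀ x y z, p x y z + q (K x) y z = 2 * symTensor g I J K (ψ ∘ₗ I) x y z) :
    IsConformalTriple g I J K p q r := by
  have hp' : ∀ x y z, p x y z = symTensor g I J K (ψ ∘ₗ I) x y z
      - symTensor g I J K (φ₀ ∘ₗ I) x y z + symTensor g I J K (φ ∘ₗ I) x y z := fun x y z => by
    have e1 := hI (K x) y z
    have e2 := hJ (J x) y z
    have e3 := hK x y z
    rw [h.quat.IK, hr.neg_left, (symTensor_comp_apply h φ₀ x y z).2.1] at e1
    rw [h.quat.JJ, hp.neg_left, (symTensor_comp_apply h φ x y z).2.2.2.2.1] at e2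
    linarith
  have hr' : ∀ x y z, r x y z = symTensor g I J K (φ ∘ₗ K) x y z
      - symTensor g I J K (ψ ∘ₗ K) x y z + symTensor g I J K (φ₀ ∘ₗ K) x y z := fun x y z => by
    have e1 := hJ x y z
    rw [hp', (symTensor_comp_apply h φ x y z).1, (symTensor_comp_apply h ψ x y z).1,
      (symTensor_comp_apply h φ₀ x y z).1] at e1
    linarith
  obtain rfl : φ = ψ := eq_of_hasType h hV h.quat.KK one_ne_zero
    (fun x y z => by simp only [Pi.sub_apply, hr']; ring) hIi
  rw [← symTensor_cyc] at hJj
  obtain rfl : φ = φ₀ := eq_of_hasType h.cyc hV h.quat.II (c := 1) one_ne_zero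
    (fun x y z => by simp only [Pi.sub_apply, hp', symTensor_cyc]; ring) hJj
  refine ⟨φ, fun x y z => by rw [hp']; ring, fun x y z => ?_, fun x y z => by rw [hr']; ring⟩
  have e1 := hI x y z
  rw [hr', (symTensor_comp_apply h φ x y z).2.2.1] at e1
  linarith

variable {α β γ : V →ₗ[ℝ] V →ₗ[ℝ] V →ₗ[ℝ] ℝ}

/-- `p, q, r` are the components of the covariant derivatives `α, β, γ` of the Kähler forms
of `I, J, K`. -/
structure IsComponents (I J K : V →ₗ[ℝ] V) (α β γ : V →ₗ[ℝ] V →ₗ[ℝ] V →ₗ[ℝ] ℝ)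
    (p q r : V → V → V → ℝ) : Prop where
  symp : QSym I J K p
  symq : QSym I J K q
  symr : QSym I J K r
  eqI : ∀ x y z, α x y z = pairTensor J K r q x y z
  eqJ : ∀ x y z, β x y z = pairTensor K I p r x y z
  eqK : ∀ x y z, γ x y z = pairTensor I J q p x y z

/-- A two-form anti-invariant under J splits into a part of type K and a part of type I; these parts
of β define p and r, and q is similarly the K-part of α. The J-part of α gives a second candidate
for r, and the skewness of γ, with `hrel`, makes the two agree. -/
lemma exists_components (h : IsQuaternionic I J K) (hα : α ∈ ghSpace I) (hβ : β ∈ ghSpace J)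
    (hγ : ∀ x y z, γ x z y = -γ x y z)
    (hrel : ∀ x y z, γ x y z = α x y (J z) - β x (I y) z) :
    ∃ p q r, IsComponents I J K α β γ p q r := by
  have sα := fun x y z => (hα x y z).1
  have sβ := fun x y z => (hβ x y z).1
  have mα := ghSpace_move h.II hα
  have mβ := ghSpace_move h.JJ hβ
  have mα' : ∀ x y z, α x (J y) (K z) = α x (K y) (J z) := fun x y z => by
    have := mα x (J y) (J z)
    rw [h.IJ, h.IJ] at this
    exact this.symm
  have mβ' : ∀ x y z, β x (I y) (K z) = β x (K y) (I z) := fun x y z => by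
    have := mβ x (I y) (I z)
    rw [h.JI, h.JI, map_neg, map_neg, LinearMap.neg_apply] at this
    linarith
  refine ⟨fun x y z => -(1 / 2) * (β x y (K z) + β x (I y) (J z)),
    fun x y z => 1 / 2 * (α x y (K z) - α x (J y) (I z)),
    fun x y z => 1 / 2 * (β x y (I z) - β x (I y) z), ?_, ?_, ?_, ?_, ?_, ?_⟩
  · constructor <;> intro x y z
    · simp only [map_neg, LinearMap.neg_apply]; ring
    · simp only [map_neg, LinearMap.neg_apply]; ring
    · have e1 := sβ x (K y) z
      have e2 := sβ x (J y) (I z)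
      have e3 := mβ x (I y) z
      have e4 := mβ x y (I z)
      simp only [h.JI, map_neg, LinearMap.neg_apply] at e3 e4
      linarith
    · simp only [h.II, h.KI, h.JI, map_neg, LinearMap.neg_apply]; ring
    · have e1 := mβ x y (K z)
      have e2 := mβ x (I y) z
      have e3 := mβ x (I y) (J z)
      simp only [h.JK, h.JI, h.JJ, h.IJ, h.KJ, map_neg, LinearMap.neg_apply] at e1 e2 e3 ⊢
      linarith
    · have e1 := mβ x (I y) (K z)
      have e2 := mβ x y (I z)
      have e3 := mβ x y (J z)
      simp only [h.JK, h.JI, h.JJ, h.IK, h.KK, map_neg, LinearMap.neg_apply] at e1 e2 e3 ⊢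
      linarith
  · constructor <;> intro x y z
    · simp only [map_neg, LinearMap.neg_apply]; ring
    · simp only [map_neg, LinearMap.neg_apply]; ring
    · have e1 := sα x (K y) z
      have e2 := sα x (J y) (I z)
      have e3 := sα x (I y) (J z)
      have e4 := mα x (J y) z
      have e5 := mα x y (J z)
      simp only [h.IJ, map_neg, LinearMap.neg_apply] at e4 e5
      linarith
    · have e1 := mα x y (K z)
      have e2 := mα x (J y) z
      have e3 := mα x (J y) (I z)
      simp only [h.KI, h.JI, h.II, h.IJ, h.IK, map_neg, LinearMap.neg_apply] at e1 e2 e3 ⊢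
      linarith
    · simp only [h.JJ, h.KJ, h.IJ, map_neg, LinearMap.neg_apply]; ring
    · have e1 := mα x (J y) (K z)
      have e2 := mα x y (J z)
      have e3 := mα x y (I z)
      simp only [h.KK, h.JK, h.IK, h.II, h.IJ, map_neg, LinearMap.neg_apply] at e1 e2 e3 ⊢
      linarith
  · constructor <;> intro x y z
    · simp only [map_neg, LinearMap.neg_apply]; ring
    · simp only [map_neg, LinearMap.neg_apply]; ring
    · have e1 := sβ x (I y) z
      have e2 := sβ x y (I z)
      linarith
    · simp only [h.II, map_neg, LinearMap.neg_apply]; ring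
    · have e1 := mβ x y (I z)
      have e2 := mβ x (I y) z
      have e3 := mβ' x y z
      simp only [h.IJ, h.JI, map_neg, LinearMap.neg_apply] at e1 e2 e3 ⊢
      linarith
    · have e1 := mβ x y z
      have e2 := mβ x (I y) (I z)
      simp only [h.IK, h.JI, map_neg, LinearMap.neg_apply] at e1 e2 ⊢
      linarith
  · intro x y z
    have e1 := hrel x y (J z)
    have e2 := hrel x (J z) y
    have e3 := hγ x y (J z)
    have e4 := sα x (J y) (J z)
    have e5 := sβ x y (K z)
    simp only [pairTensor, h.JJ, h.IJ, h.KK, h.IK, map_neg, LinearMap.neg_apply] at *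
    linarith
  · intro x y z
    simp only [pairTensor, h.II, h.KK, h.JK, map_neg, LinearMap.neg_apply]
    ring
  · intro x y z
    have e1 := hrel x y z
    have e2 := sα x y (J z)
    have e3 := sβ x (I y) z
    have e4 := hrel x z y
    have e5 := hγ x y z
    have e6 := sα x z (J y)
    have e7 := sβ x (I z) y
    simp only [pairTensor, h.KI, h.II, h.KJ, h.JJ, map_neg, LinearMap.neg_apply] at *
    linarith

namespace IsComponents

variable (hc : IsComponents I J K α β γ p q r) (h : IsHermitianFrame g I J K)

include hc h

lemma four_I (hm : α ∈ ghClass g I {4}) : ∃ φ : V →ₗ[ℝ] ℝ,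
    r = symTensor g I J K (φ ∘ₗ K) ∧ q = symTensor g I J K (φ ∘ₗ J) :=
  components_of_mem_four h hc.symr hc.symq hc.eqI hm

lemma pair_I {i : ℕ} (hi : i = 1 ∨ i = 2) (hm : α ∈ ghClass g I {i, 4}) : ∃ φ : V →ₗ[ℝ] ℝ,
    (∀ x y z, q x y z + r (I x) y z = 2 * symTensor g I J K (φ ∘ₗ J) x y z) ∧
    HasType i (twist I J K (r - symTensor g I J K (φ ∘ₗ K))) :=
  components_of_mem_pair h hc.symr hc.symq hc.eqI hi hm

lemma pair_J {i : ℕ} (hi : i = 1 ∨ i = 2) (hm : β ∈ ghClass g J {i, 4}) : ∃ φ : V →ₗ[ℝ] ℝ,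
    (∀ x y z, r x y z + p (J x) y z = 2 * symTensor g I J K (φ ∘ₗ K) x y z) ∧
    HasType i (twist J K I (p - symTensor g I J K (φ ∘ₗ I))) := by
  simpa only [symTensor_cyc] using
    components_of_mem_pair h.cyc hc.symp.cyc hc.symr.cyc hc.eqJ hi hm

lemma three_I (hm : α ∈ ghClass g I {3, 4}) (x y z : V) : q x y z = r (I x) y z :=
  components_of_mem_three_four h hc.symr hc.symq hc.eqI hm x y z

lemma three_J (hm : β ∈ ghClass g J {3, 4}) (x y z : V) : r x y z = p (J x) y z :=
  components_of_mem_three_four h.cyc hc.symp.cyc hc.symr.cyc hc.eqJ hm x y z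

lemma three_K (hm : γ ∈ ghClass g K {3, 4}) (x y z : V) : p x y z = q (K x) y z :=
  components_of_mem_three_four h.cyc.cyc hc.symq.cyc.cyc hc.symp.cyc.cyc hc.eqK hm x y z

lemma one_two_J (hm : β ∈ ghClass g J {1, 2, 4}) : ∃ φ : V →ₗ[ℝ] ℝ,
    ∀ x y z, r x y z + p (J x) y z = 2 * symTensor g I J K (φ ∘ₗ K) x y z := by
  simpa only [symTensor_cyc] using
    components_of_mem_one_two_four h.cyc hc.symp.cyc hc.symr.cyc hc.eqJ hm

lemma one_two_K (hm : γ ∈ ghClass g K {1, 2, 4}) : ∃ φ : V →ₗ[ℝ] ℝ,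
    ∀ x y z, p x y z + q (K x) y z = 2 * symTensor g I J K (φ ∘ₗ I) x y z := by
  simpa only [symTensor_cyc] using
    components_of_mem_one_two_four h.cyc.cyc hc.symq.cyc.cyc hc.symp.cyc.cyc hc.eqK hm

lemma add_three_J {i : ℕ} (hi : i = 1 ∨ i = 2) (hm : β ∈ ghClass g J {i, 3, 4}) :
    HasType i (twist J K I fun x y z => p x y z + r (J x) y z) :=
  components_of_mem_three_four_add h.cyc hc.symp.cyc hc.symr.cyc hc.eqJ hi hm

lemma add_three_K {i : ℕ} (hi : i = 1 ∨ i = 2) (hm : γ ∈ ghClass g K {i, 3, 4}) :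
    HasType i (twist K I J fun x y z => q x y z + p (K x) y z) :=
  components_of_mem_three_four_add h.cyc.cyc hc.symq.cyc.cyc hc.symp.cyc.cyc hc.eqK hi hm

lemma conformal_of_four_pair (hV : 4 < Module.finrank ℝ V) {i : ℕ} (hi : i = 1 ∨ i = 2)
    (hα : α ∈ ghClass g I {4}) (hβ : β ∈ ghClass g J {i, 4}) :
    IsConformalTriple g I J K p q r := by
  obtain ⟨φ₀, hr, hq⟩ := hc.four_I h hα
  obtain ⟨φ, hJ, hJi⟩ := hc.pair_J h hi hβ
  have hp : ∀ x y z, p x y z = 2 * symTensor g I J K (φ ∘ₗ I) x y z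
      - symTensor g I J K (φ₀ ∘ₗ I) x y z := fun x y z => by
    have e := hJ (J x) y z
    rw [hr, h.quat.JJ, hc.symp.neg_left, (symTensor_comp_apply h φ x y z).2.2.2.2.1,
      (symTensor_comp_apply h φ₀ x y z).2.2.2.2.1] at e
    linarith
  rw [← symTensor_cyc] at hJi
  obtain rfl : φ = φ₀ := eq_of_hasType h.cyc hV h.quat.II (c := 1) one_ne_zero
    (fun x y z => by simp only [Pi.sub_apply, hp, symTensor_cyc]; ring) hJi
  exact ⟨φ, fun x y z => by rw [hp]; ring, fun x y z => by rw [hq], fun x y z => by rw [hr]⟩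

lemma conformal_of_four_three (hα : α ∈ ghClass g I {4}) (hβ : β ∈ ghClass g J {3, 4}) :
    IsConformalTriple g I J K p q r := by
  obtain ⟨φ, hr, hq⟩ := hc.four_I h hα
  refine ⟨φ, fun x y z => ?_, fun x y z => by rw [hq], fun x y z => by rw [hr]⟩
  have e := hc.three_J h hβ (J x) y z
  rw [hr, h.quat.JJ, hc.symp.neg_left, (symTensor_comp_apply h φ x y z).2.2.2.2.1] at e
  linarith

lemma conformal_of_pair_pair (hV : 4 < Module.finrank ℝ V) {i j : ℕ} (hi : i = 1 ∨ i = 2)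
    (hj : j = 1 ∨ j = 2) (hα : α ∈ ghClass g I {i, 4}) (hβ : β ∈ ghClass g J {j, 4})
    (hγ : γ ∈ ghClass g K {1, 2, 4}) : IsConformalTriple g I J K p q r := by
  obtain ⟨φ₀, hI, hIi⟩ := hc.pair_I h hi hα
  obtain ⟨φ, hJ, hJj⟩ := hc.pair_J h hj hβ
  obtain ⟨ψ, hK⟩ := hc.one_two_K h hγ
  exact conformal_of_anti h hV hc.symr hI hIi hc.symp hJ hJj hK

/-- The two W₃ + W₄ relations compose to q(Kx) = p(x), so the relation for K reads 2p = 2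
`symTensor`. -/
lemma conformal_of_three_three (hα : α ∈ ghClass g I {3, 4}) (hβ : β ∈ ghClass g J {3, 4})
    (hγ : γ ∈ ghClass g K {1, 2, 4}) : IsConformalTriple g I J K p q r := by
  obtain ⟨ψ, hK⟩ := hc.one_two_K h hγ
  have hp : ∀ x y z, p x y z = symTensor g I J K (ψ ∘ₗ I) x y z := fun x y z => by
    have e1 := hc.three_I h hα (K x) y z
    have e2 := hc.three_J h hβ (J x) y z
    have e3 := hK x y z
    rw [h.quat.IK, hc.symr.neg_left] at e1
    rw [h.quat.JJ, hc.symp.neg_left] at e2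
    linarith
  have hr : ∀ x y z, r x y z = symTensor g I J K (ψ ∘ₗ K) x y z := fun x y z => by
    rw [hc.three_J h hβ, hp, (symTensor_comp_apply h ψ x y z).1]
  refine ⟨ψ, hp, fun x y z => ?_, hr⟩
  rw [hc.three_I h hα, hr, (symTensor_comp_apply h ψ x y z).2.2.1]

lemma conformal_of_pair_three_three {i : ℕ} (hi : i = 1 ∨ i = 2) (hα : α ∈ ghClass g I {i, 4})
    (hβ : β ∈ ghClass g J {3, 4}) (hγ : γ ∈ ghClass g K {3, 4}) :
    IsConformalTriple g I J K p q r := by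
  obtain ⟨φ, hI, -⟩ := hc.pair_I h hi hα
  have hq : ∀ x y z, q x y z = symTensor g I J K (φ ∘ₗ J) x y z := fun x y z => by
    have e1 := hI x y z
    have e2 := hc.three_J h hβ (I x) y z
    have e3 := hc.three_K h hγ (K x) y z
    rw [h.quat.JI, hc.symp.neg_left] at e2
    rw [h.quat.KK, hc.symq.neg_left] at e3
    linarith
  have hp : ∀ x y z, p x y z = symTensor g I J K (φ ∘ₗ I) x y z := fun x y z => by
    rw [hc.three_K h hγ, hq, (symTensor_comp_apply h φ x y z).2.1]
  refine ⟨φ, hp, hq, fun x y z => ?_⟩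
  rw [hc.three_J h hβ, hp, (symTensor_comp_apply h φ x y z).1]

lemma conformal_of_pair_three_add {i j : ℕ} (hi : i = 1 ∨ i = 2) (hj : j = 1 ∨ j = 2)
    (hij : i ≠ j) (hα : α ∈ ghClass g I {i, 4})
    (hβ : β ∈ ghClass g J {3, 4}) (hγ : γ ∈ ghClass g K {j, 3, 4}) :
    IsConformalTriple g I J K p q r := by
  obtain ⟨φ, hI, hIi⟩ := hc.pair_I h hi hα
  have hKj := hc.add_three_K h hj hγ
  have hqp : ∀ x y z, q x y z = 2 * symTensor g I J K (φ ∘ₗ J) x y z + p (K x) y z :=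
    fun x y z => by
      have e1 := hI x y z
      have e2 := hc.three_J h hβ (I x) y z
      rw [h.quat.JI, hc.symp.neg_left] at e2
      linarith
  -- With s = r - `symTensor` (φ∘K), the tensor governing the Wⱼ part of γ is q(x) + p(Kx) = -2
  -- s(Ix). Thus s has type i through I and type j through K.
  have h0 := (hc.symr.sub (symTensor_qSym h (φ ∘ₗ K))).cyc.cyc.eq_zero_of_hasType
    h.quat.cyc.cyc (Ne.symm hij) (hKj.smul (-1 / 2) fun x y z => by
      have e1 := hI x y (I z)
      have e2 := hI (K x) y (J z)
      have e3 := hqp x y (I z)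
      have e4 := hqp (K x) y (J z)
      have e5 := (symTensor_comp_apply h φ x y (I z)).2.2.1
      have e6 := (symTensor_comp_apply h φ (K x) y (J z)).2.2.1
      simp only [twist, Pi.sub_apply]
      linarith) hIi
  rw [sub_eq_zero] at h0
  have hq : ∀ x y z, q x y z = symTensor g I J K (φ ∘ₗ J) x y z := fun x y z => by
    have e := hI x y z
    rw [h0, (symTensor_comp_apply h φ x y z).2.2.1] at e
    linarith
  refine ⟨φ, fun x y z => ?_, hq, fun x y z => by rw [h0]⟩
  have e := hc.three_J h hβ (J x) y z
  rw [h0, h.quat.JJ, hc.symp.neg_left, (symTensor_comp_apply h φ x y z).2.2.2.2.1] at e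
  linarith

lemma conformal_of_one_two_add (hV : 4 < Module.finrank ℝ V) {k : ℕ} (hk : k = 1 ∨ k = 2)
    (hα : α ∈ ghClass g I {1, 4}) (hβ : β ∈ ghClass g J {2, 4})
    (hγ : γ ∈ ghClass g K {k, 3, 4}) : IsConformalTriple g I J K p q r := by
  obtain ⟨φ₀, hI, hI1⟩ := hc.pair_I h (Or.inl rfl) hα
  obtain ⟨φ, hJ, hJ2⟩ := hc.pair_J h (Or.inr rfl) hβ
  have hKk := hc.add_three_K h hk hγ
  -- Eliminating r between the relations for I and J leaves q(x) + p(Kx) equal to twice the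
  -- difference of the two symmetrizations, and by the hypothesis on γ this has pure type k.
  obtain rfl : φ₀ = φ := by
    refine eq_of_hasType h.cyc.cyc hV h.quat.JJ (c := 2) two_ne_zero (fun x y z => ?_) hKk
    have e1 := hI x y z
    have e2 := hJ (I x) y z
    rw [h.quat.JI, hc.symp.neg_left, (symTensor_comp_apply h φ x y z).2.2.1] at e2
    simp only [symTensor_cyc]
    linarith
  have hr : ∀ x y z, (r - symTensor g I J K (φ₀ ∘ₗ K)) x y z =
      -(p - symTensor g I J K (φ₀ ∘ₗ I)) (J x) y z := fun x y z => by
    have e := hJ x y z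
    simp only [Pi.sub_apply, (symTensor_comp_apply h φ₀ x y z).1]
    linarith
  have h0 := (hc.symp.sub (symTensor_qSym h (φ₀ ∘ₗ I))).eq_zero_of_hasType h.quat
    (by decide : 1 ≠ 2) (hI1.smul (-1) fun x y z => by simp only [twist, hr]; ring) hJ2
  have hr' : ∀ x y z, r x y z = symTensor g I J K (φ₀ ∘ₗ K) x y z := fun x y z => by
    have e := hr x y z
    rw [h0] at e
    simp only [Pi.sub_apply, Pi.zero_apply] at e
    linarith
  refine ⟨φ₀, fun x y z => by rw [sub_eq_zero.1 h0], fun x y z => ?_, hr'⟩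
  have e := hI x y z
  rw [hr', (symTensor_comp_apply h φ₀ x y z).2.2.1] at e
  linarith

lemma conformal_of_four_anti_add (hV : 4 < Module.finrank ℝ V) {k : ℕ} (hk : k = 1 ∨ k = 2)
    (hα : α ∈ ghClass g I {4}) (hβ : β ∈ ghClass g J {1, 2, 4})
    (hγ : γ ∈ ghClass g K {k, 3, 4}) : IsConformalTriple g I J K p q r := by
  obtain ⟨φ₀, hr, hq⟩ := hc.four_I h hα
  obtain ⟨φ, hJ⟩ := hc.one_two_J h hβ
  have hp : ∀ x y z, p x y z = 2 * symTensor g I J K (φ ∘ₗ I) x y z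
      - symTensor g I J K (φ₀ ∘ₗ I) x y z := fun x y z => by
    have e := hJ (J x) y z
    rw [hr, h.quat.JJ, hc.symp.neg_left, (symTensor_comp_apply h φ x y z).2.2.2.2.1,
      (symTensor_comp_apply h φ₀ x y z).2.2.2.2.1] at e
    linarith
  obtain rfl : φ₀ = φ := by
    refine eq_of_hasType h.cyc.cyc hV h.quat.JJ (c := 2) two_ne_zero (fun x y z => ?_)
      (hc.add_three_K h hk hγ)
    simp only [hp, hq, symTensor_cyc, (symTensor_comp_apply h φ x y z).2.2.2.2.2,
      (symTensor_comp_apply h φ₀ x y z).2.2.2.2.2]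
    ring
  exact ⟨φ₀, fun x y z => by rw [hp]; ring, fun x y z => by rw [hq], fun x y z => by rw [hr]⟩

lemma conformal_of_four_add_anti (hV : 4 < Module.finrank ℝ V) {k : ℕ} (hk : k = 1 ∨ k = 2)
    (hα : α ∈ ghClass g I {4}) (hβ : β ∈ ghClass g J {k, 3, 4})
    (hγ : γ ∈ ghClass g K {1, 2, 4}) : IsConformalTriple g I J K p q r := by
  obtain ⟨φ₀, hr, hq⟩ := hc.four_I h hα
  obtain ⟨ψ, hK⟩ := hc.one_two_K h hγ
  have hp : ∀ x y z, p x y z = 2 * symTensor g I J K (ψ ∘ₗ I) x y z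
      - symTensor g I J K (φ₀ ∘ₗ I) x y z := fun x y z => by
    have e := hK x y z
    rw [hq, (symTensor_comp_apply h φ₀ x y z).2.1] at e
    linarith
  obtain rfl : ψ = φ₀ := by
    refine eq_of_hasType h.cyc hV h.quat.II (c := 2) two_ne_zero (fun x y z => ?_)
      (hc.add_three_J h hk hβ)
    simp only [hp, hr, symTensor_cyc, (symTensor_comp_apply h φ₀ x y z).2.2.2.2.1]
    ring
  exact ⟨ψ, fun x y z => by rw [hp]; ring, fun x y z => by rw [hq], fun x y z => by rw [hr]⟩

lemma conformal_of_four_add_add {i j : ℕ} (hi : i = 1 ∨ i = 2) (hj : j = 1 ∨ j = 2)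
    (hij : i ≠ j) (hα : α ∈ ghClass g I {4}) (hβ : β ∈ ghClass g J {i, 3, 4})
    (hγ : γ ∈ ghClass g K {j, 3, 4}) : IsConformalTriple g I J K p q r := by
  obtain ⟨φ, hr, hq⟩ := hc.four_I h hα
  have hs := hc.symp.sub (symTensor_qSym h (φ ∘ₗ I))
  -- Since q and r are conformal, only s = p - `symTensor` (φ∘I) remains. The vanishing criterion is
  -- applied to s(Kx) in the frame (J, K, I); there K² = -1 turns the first type condition into one
  -- on -s.
  have h0 := (hs.comp K).cyc.eq_zero_of_hasType h.quat.cyc hij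
    ((hc.add_three_J h hi hβ).smul (-1) fun x y z => by
      simp only [twist, h.quat.KK, hs.neg_left]
      simp only [Pi.sub_apply, hr, (symTensor_comp_apply h φ _ _ _).2.2.2.2.1]
      ring)
    ((hc.add_three_K h hj hγ).smul 1 fun x y z => by
      simp only [twist, Pi.sub_apply, hq, (symTensor_comp_apply h φ _ _ _).2.2.2.2.2]
      ring)
  refine ⟨φ, fun x y z => ?_, fun x y z => by rw [hq], fun x y z => by rw [hr]⟩
  have e := congrFun (congrFun (congrFun h0 (K x)) y) z
  simp only [h.quat.KK, hs.neg_left, Pi.sub_apply, Pi.zero_apply] at e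
  linarith

end IsComponents

/-- Under each of the five hypotheses on the Gray–Hervella classes, the covariant derivatives of
the three Kähler forms are those of an infinitesimal conformal change. -/
theorem exists_confForm (h : IsHermitianFrame g I J K) (hV : 4 < Module.finrank ℝ V)
    (hγ : ∀ x y z, γ x z y = -γ x y z)
    (hrel : ∀ x y z, γ x y z = α x y (J z) - β x (I y) z)
    (hcases :
      (∃ i ∈ ({1, 2, 3} : Finset ℕ), α ∈ ghClass g I {4} ∧ β ∈ ghClass g J {i, 4}) ∨
      (∃ i ∈ ({1, 2, 3} : Finset ℕ), α ∈ ghClass g I {i, 4} ∧ β ∈ ghClass g J {i, 4} ∧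
        γ ∈ ghClass g K {1, 2, 4}) ∨
      (∃ i ∈ ({1, 2} : Finset ℕ), ∃ j ∈ ({1, 2, 3} : Finset ℕ), i ≠ j ∧
        α ∈ ghClass g I {i, 4} ∧ β ∈ ghClass g J {3, 4} ∧ γ ∈ ghClass g K {j, 3, 4}) ∨
      (∃ i ∈ ({1, 2, 3} : Finset ℕ), ∃ j ∈ ({1, 2, 3} : Finset ℕ), i ≠ j ∧
        α ∈ ghClass g I {1, 4} ∧ β ∈ ghClass g J {2, 4} ∧ γ ∈ ghClass g K {i, j, 4}) ∨
      (∃ C ∈ ({{1, 2}, {1, 3}, {2, 3}} : Finset (Finset ℕ)),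
        ∃ D ∈ ({{1, 2}, {1, 3}, {2, 3}} : Finset (Finset ℕ)), C ≠ D ∧
        α ∈ ghClass g I {4} ∧ β ∈ ghClass g J (C ∪ {4}) ∧ γ ∈ ghClass g K (D ∪ {4}))) :
    ∃ φ : V →ₗ[ℝ] ℝ, (∀ x y z, α x y z = confForm g I φ x y z) ∧
      (∀ x y z, β x y z = confForm g J φ x y z) ∧ ∀ x y z, γ x y z = confForm g K φ x y z := by
  have hαβ : α ∈ ghSpace I ∧ β ∈ ghSpace J := by
    have hI := ghClass_le_ghSpace (g := g) h.quat.II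
    have hJ := ghClass_le_ghSpace (g := g) h.quat.JJ
    rcases hcases with ⟨_, _, h1, h2⟩ | ⟨_, _, h1, h2, _⟩ | ⟨_, _, _, _, _, h1, h2, _⟩ |
      ⟨_, _, _, _, _, h1, h2, _⟩ | ⟨_, _, _, _, _, h1, h2, _⟩ <;> exact ⟨hI _ h1, hJ _ h2⟩
  obtain ⟨p, q, r, hc⟩ := exists_components h.quat hαβ.1 hαβ.2 hγ hrel
  have e1 : ({1, 2} ∪ {4} : Finset ℕ) = {1, 2, 4} := by decide
  have e2 : ({1, 3} ∪ {4} : Finset ℕ) = {1, 3, 4} := by decide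
  have e3 : ({2, 3} ∪ {4} : Finset ℕ) = {2, 3, 4} := by decide
  have e4 : ({3, 3, 4} : Finset ℕ) = {3, 4} := by decide
  have e5 : ({2, 1, 4} : Finset ℕ) = {1, 2, 4} := by decide
  have e6 : ({3, 1, 4} : Finset ℕ) = {1, 3, 4} := by decide
  have e7 : ({3, 2, 4} : Finset ℕ) = {2, 3, 4} := by decide
  have o1 : 1 = 1 ∨ 1 = 2 := Or.inl rfl
  have o2 : 2 = 1 ∨ 2 = 2 := Or.inr rfl
  have n12 : 1 ≠ 2 := by decide
  suffices hs : IsConformalTriple g I J K p q r by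
    obtain ⟨φ, hp, hq, hr⟩ := hs
    refine ⟨φ, fun x y z => ?_, fun x y z => ?_, fun x y z => ?_⟩
    · rw [confForm_eq h, hc.eqI, pairTensor, hr, hq]
    · rw [confForm_eq h.cyc, hc.eqJ, pairTensor, hp, hr]
      simp only [symTensor_cyc]
    · rw [confForm_eq h.cyc.cyc, hc.eqK, pairTensor, hq, hp]
      simp only [symTensor_cyc]
  rcases hcases with ⟨i, hi, hα, hβ⟩ | ⟨i, hi, hα, hβ, hγ⟩ | ⟨i, hi, j, hj, hij, hα, hβ, hγ⟩ |
      ⟨i, hi, j, hj, hij, hα, hβ, hγ⟩ | ⟨C, hC, D, hD, hCD, hα, hβ, hγ⟩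
  · simp only [Finset.mem_insert, Finset.mem_singleton] at hi
    rcases hi with rfl | rfl | rfl
    · exact hc.conformal_of_four_pair h hV o1 hα hβ
    · exact hc.conformal_of_four_pair h hV o2 hα hβ
    · exact hc.conformal_of_four_three h hα hβ
  · simp only [Finset.mem_insert, Finset.mem_singleton] at hi
    rcases hi with rfl | rfl | rfl
    · exact hc.conformal_of_pair_pair h hV o1 o1 hα hβ hγ
    · exact hc.conformal_of_pair_pair h hV o2 o2 hα hβ hγ
    · exact hc.conformal_of_three_three h hα hβ hγ
  · simp only [Finset.mem_insert, Finset.mem_singleton] at hi hj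
    rcases hj with rfl | rfl | rfl
    · exact hc.conformal_of_pair_three_add h hi o1 hij hα hβ hγ
    · exact hc.conformal_of_pair_three_add h hi o2 hij hα hβ hγ
    · rw [e4] at hγ
      exact hc.conformal_of_pair_three_three h hi hα hβ hγ
  · simp only [Finset.mem_insert, Finset.mem_singleton] at hi hj
    rcases hi with rfl | rfl | rfl <;> rcases hj with rfl | rfl | rfl <;>
      first
      | exact absurd rfl hij
      | simp only [e5, e6, e7] at hγ
      | skip
    · exact hc.conformal_of_pair_pair h hV o1 o2 hα hβ hγ
    · exact hc.conformal_of_one_two_add h hV o1 hα hβ hγ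
    · exact hc.conformal_of_pair_pair h hV o1 o2 hα hβ hγ
    · exact hc.conformal_of_one_two_add h hV o2 hα hβ hγ
    · exact hc.conformal_of_one_two_add h hV o1 hα hβ hγ
    · exact hc.conformal_of_one_two_add h hV o2 hα hβ hγ
  · simp only [Finset.mem_insert, Finset.mem_singleton] at hC hD
    rcases hC with rfl | rfl | rfl <;> rcases hD with rfl | rfl | rfl <;>
      first
      | exact absurd rfl hCD
      | simp only [e1, e2, e3] at hβ hγ
    · exact hc.conformal_of_four_anti_add h hV o1 hα hβ hγ
    · exact hc.conformal_of_four_anti_add h hV o2 hα hβ hγ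
    · exact hc.conformal_of_four_add_anti h hV o1 hα hβ hγ
    · exact hc.conformal_of_four_add_add h o1 o2 n12 hα hβ hγ
    · exact hc.conformal_of_four_add_anti h hV o2 hα hβ hγ
    · exact hc.conformal_of_four_add_add h o2 o1 n12.symm hα hβ hγ

end PointwiseClassification

/-! ### Smoothness and closedness of N when dΩ = N ∧ Ω. -/

section ClosedForms

variable {E : Type*} [NormedAddCommGroup E] [NormedSpace ℝ E]

/-- A vector field `N` is smooth as soon as its image under a smooth family of injective linear
maps is smooth. -/
lemma contDiffAt_of_injective {W G : Type*} [NormedAddCommGroup W] [NormedSpace ℝ W]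
    [NormedAddCommGroup G] [NormedSpace ℝ G] [FiniteDimensional ℝ W] [FiniteDimensional ℝ G]
    {L : E → W →L[ℝ] G} {N : E → W} {p : E} {k : ℕ∞ω} (hL : ContDiffAt ℝ k L p)
    (hLN : ContDiffAt ℝ k (fun u => L u (N u)) p) (hinj : ∀ w, L p w = 0 → w = 0) :
    ContDiffAt ℝ k N p := by
  -- With R a fixed left inverse of L at p, the endomorphism R L(u) is the identity at p and so
  -- invertible nearby; there N = (R L)⁻¹ R (L N).
  obtain ⟨R, hR⟩ := (L p : W →ₗ[ℝ] G).exists_leftInverse_of_injective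
    (LinearMap.ker_eq_bot'.2 hinj)
  let R' : G →L[ℝ] W := LinearMap.toContinuousLinearMap R
  have hM : ContDiffAt ℝ k (fun u => R'.comp (L u)) p := contDiffAt_const.clm_comp hL
  have hMp : R'.comp (L p) = ContinuousLinearEquiv.refl ℝ W := by
    ext w
    exact LinearMap.congr_fun hR w
  have hinv : ContDiffAt ℝ k (fun u => (R'.comp (L u)).inverse) p := by
    have h1 := contDiffAt_map_inverse (𝕜 := ℝ) (n := k) (ContinuousLinearEquiv.refl ℝ W)
    rw [← hMp] at h1
    exact h1.comp p hM
  refine (hinv.clm_apply (contDiffAt_const.clm_apply hLN : ContDiffAt ℝ k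
    (fun u => R' (L u (N u))) p)).congr_of_eventuallyEq ?_
  have hnhds : ∀ᶠ u in nhds p, R'.comp (L u) ∈
      range ((↑) : (W ≃L[ℝ] W) → W →L[ℝ] W) := by
    refine hM.continuousAt.eventually ?_
    beta_reduce
    rw [hMp]
    exact ContinuousLinearEquiv.nhds _
  filter_upwards [hnhds] with u ⟨e, he⟩
  change N u = (R'.comp (L u)).inverse ((R'.comp (L u)) (N u))
  rw [← he, ContinuousLinearMap.inverse_equiv]
  simp

/-- Cyclic permutation of the arguments of a trilinear form. -/
def cycCLM (E : Type*) [NormedAddCommGroup E] [NormedSpace ℝ E] :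
    (E →L[ℝ] E →L[ℝ] E →L[ℝ] ℝ) →L[ℝ] E →L[ℝ] E →L[ℝ] E →L[ℝ] ℝ :=
  (ContinuousLinearMap.flipₗᵢ ℝ E E (E →L[ℝ] ℝ)).toContinuousLinearEquiv.toContinuousLinearMap.comp
    (ContinuousLinearMap.compL ℝ E (E →L[ℝ] E →L[ℝ] ℝ) (E →L[ℝ] E →L[ℝ] ℝ)
      (ContinuousLinearMap.flipₗᵢ ℝ E E ℝ).toContinuousLinearEquiv.toContinuousLinearMap)

@[simp] lemma cycCLM_apply (t : E →L[ℝ] E →L[ℝ] E →L[ℝ] ℝ) (a b c : E) :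
    cycCLM E t a b c = t b c a := rfl

/-- The cyclic sum of a trilinear form. -/
def cycSum (E : Type*) [NormedAddCommGroup E] [NormedSpace ℝ E] :
    (E →L[ℝ] E →L[ℝ] E →L[ℝ] ℝ) →L[ℝ] E →L[ℝ] E →L[ℝ] E →L[ℝ] ℝ :=
  ContinuousLinearMap.id ℝ _ + cycCLM E + (cycCLM E).comp (cycCLM E)

lemma cycSum_apply (t : E →L[ℝ] E →L[ℝ] E →L[ℝ] ℝ) (a b c : E) :
    cycSum E t a b c = t a b c + t b c a + t c a b := by
  simp [cycSum]

/-- The wedge product of a two-form and a one-form. -/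
def wedgeCLM (E : Type*) [NormedAddCommGroup E] [NormedSpace ℝ E] :
    (E →L[ℝ] E →L[ℝ] ℝ) →L[ℝ] (E →L[ℝ] ℝ) →L[ℝ] E →L[ℝ] E →L[ℝ] E →L[ℝ] ℝ :=
  (ContinuousLinearMap.compL ℝ (E →L[ℝ] ℝ) (E →L[ℝ] E →L[ℝ] E →L[ℝ] ℝ)
    (E →L[ℝ] E →L[ℝ] E →L[ℝ] ℝ) (cycSum E)).comp
    (ContinuousLinearMap.smulRightL ℝ E (E →L[ℝ] E →L[ℝ] ℝ)).flip

lemma wedgeCLM_apply (B : E →L[ℝ] E →L[ℝ] ℝ) (l : E →L[ℝ] ℝ) (a b c : E) :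
    wedgeCLM E B l a b c = l a * B b c + l b * B c a + l c * B a b := by
  change cycSum E (ContinuousLinearMap.smulRight l B) a b c = _
  rw [cycSum_apply]
  rfl

set_option synthInstance.maxHeartbeats 400000 in
set_option maxHeartbeats 1000000 in
/-- Let `Ω` be a smooth field of nondegenerate two-forms with `dΩ = N ∧ Ω`.
Then the one-form `N` is smooth. -/
lemma contDiffOn_of_wedge [FiniteDimensional ℝ E] {O : Set E} (hO : IsOpen O) {Ω : E → E →L[ℝ] E →L[ℝ] ℝ}
    (hΩ : ContDiffOn ℝ ∞ Ω O) {N : E → E →L[ℝ] ℝ}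
    (hd : ∀ u ∈ O, ∀ a b c, fderiv ℝ Ω u a b c + fderiv ℝ Ω u b c a + fderiv ℝ Ω u c a b =
      N u a * Ω u b c + N u b * Ω u c a + N u c * Ω u a b)
    (hinj : ∀ u ∈ O, ∀ l : E →L[ℝ] ℝ,
      (∀ a b c, l a * Ω u b c + l b * Ω u c a + l c * Ω u a b = 0) → l = 0) :
    ContDiffOn ℝ ∞ N O := by
  intro p hp
  have hΩp : ContDiffAt ℝ ∞ Ω p := hΩ.contDiffAt (hO.mem_nhds hp)
  have hL : ContDiffAt ℝ ∞ (fun u => wedgeCLM E (Ω u)) p := contDiffAt_const.clm_apply hΩp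
  have hD : ContDiffAt ℝ ∞ (fun u => cycSum E (fderiv ℝ Ω u)) p :=
    contDiffAt_const.clm_apply (hΩp.fderiv_right (by simp))
  refine (contDiffAt_of_injective hL (hD.congr_of_eventuallyEq ?_) ?_).contDiffWithinAt
  · filter_upwards [hO.mem_nhds hp] with u hu
    ext a b c
    rw [cycSum_apply, hd u hu, wedgeCLM_apply]
  · intro l hl
    refine hinj p hp l fun a b c => ?_
    rw [← wedgeCLM_apply, hl]
    rfl

set_option maxHeartbeats 1000000 in
/-- Let `Ω` be a smooth field of two-forms with `dΩ = N ∧ Ω`. Then `dN ∧ Ω = 0`. -/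
lemma fderiv_wedge_eq_zero {O : Set E} (hO : IsOpen O) {Ω : E → E →L[ℝ] E →L[ℝ] ℝ}
    (hΩ : ContDiffOn ℝ ∞ Ω O) (hskew : ∀ u ∈ O, ∀ a b, Ω u a b = -Ω u b a)
    {N : E → E →L[ℝ] ℝ} (hN : ContDiffOn ℝ ∞ N O)
    (hd : ∀ u ∈ O, ∀ a b c, fderiv ℝ Ω u a b c + fderiv ℝ Ω u b c a + fderiv ℝ Ω u c a b =
      N u a * Ω u b c + N u b * Ω u c a + N u c * Ω u a b) {u : E} (hu : u ∈ O) (a b c d : E) :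
    (fderiv ℝ N u a b - fderiv ℝ N u b a) * Ω u c d
      - (fderiv ℝ N u a c - fderiv ℝ N u c a) * Ω u b d
      + (fderiv ℝ N u a d - fderiv ℝ N u d a) * Ω u b c
      + (fderiv ℝ N u b c - fderiv ℝ N u c b) * Ω u a d
      - (fderiv ℝ N u b d - fderiv ℝ N u d b) * Ω u a c
      + (fderiv ℝ N u c d - fderiv ℝ N u d c) * Ω u a b = 0 := by
  have hΩu : ContDiffAt ℝ ∞ Ω u := hΩ.contDiffAt (hO.mem_nhds hu)
  have hNu : ContDiffAt ℝ ∞ N u := hN.contDiffAt (hO.mem_nhds hu)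
  have hΩ1 : HasFDerivAt Ω (fderiv ℝ Ω u) u := (hΩu.differentiableAt (by simp)).hasFDerivAt
  have hN1 : HasFDerivAt N (fderiv ℝ N u) u := (hNu.differentiableAt (by simp)).hasFDerivAt
  have hΩ2 : HasFDerivAt (fderiv ℝ Ω) (fderiv ℝ (fderiv ℝ Ω) u) u :=
    ((hΩu.fderiv_right (m := ∞) (by simp)).differentiableAt (by simp)).hasFDerivAt
  have hsymm : ∀ v w, fderiv ℝ (fderiv ℝ Ω) u v w = fderiv ℝ (fderiv ℝ Ω) u w v :=
    hΩu.isSymmSndFDerivAt (by rw [minSmoothness_of_isRCLikeNormedField]; exact WithTop.coe_le_coe.2 (le_top : (2 : ℕ∞) ≤ ⊤))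
  have eΩ : ∀ x y v, HasFDerivAt (fun w => Ω w x y)
      (((fderiv ℝ Ω u).flip x).flip y) u ∧ (((fderiv ℝ Ω u).flip x).flip y) v =
        fderiv ℝ Ω u v x y := fun x y v =>
    ⟨by simpa using! (hΩ1.clm_apply (hasFDerivAt_const x u)).clm_apply (hasFDerivAt_const y u), rfl⟩
  have eD : ∀ x y z, HasFDerivAt (fun w => fderiv ℝ Ω w x y z)
      ((((fderiv ℝ (fderiv ℝ Ω) u).flip x).flip y).flip z) u := fun x y z => by
    simpa using! ((hΩ2.clm_apply (hasFDerivAt_const x u)).clm_apply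
      (hasFDerivAt_const y u)).clm_apply (hasFDerivAt_const z u)
  have eN : ∀ x, HasFDerivAt (fun w => N w x) ((fderiv ℝ N u).flip x) u := fun x => by
    simpa using! hN1.clm_apply (hasFDerivAt_const x u)
  have key : ∀ v x y z,
      fderiv ℝ (fderiv ℝ Ω) u v x y z + fderiv ℝ (fderiv ℝ Ω) u v y z x
        + fderiv ℝ (fderiv ℝ Ω) u v z x y =
      N u x * fderiv ℝ Ω u v y z + Ω u y z * fderiv ℝ N u v x
        + (N u y * fderiv ℝ Ω u v z x + Ω u z x * fderiv ℝ N u v y)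
        + (N u z * fderiv ℝ Ω u v x y + Ω u x y * fderiv ℝ N u v z) := fun v x y z => by
    have h1 := ((eD x y z).add (eD y z x)).add (eD z x y)
    have h2 := (((eN x).mul (eΩ y z v).1).add ((eN y).mul (eΩ z x v).1)).add
      ((eN z).mul (eΩ x y v).1)
    have h3 := h1.unique (h2.congr_of_eventuallyEq (by
      filter_upwards [hO.mem_nhds hu] with w hw
      exact hd w hw x y z))
    have h4 := congrArg (fun l : E →L[ℝ] ℝ => l v) h3
    simpa using h4
  have dskew : ∀ v x y, fderiv ℝ Ω u v x y = -fderiv ℝ Ω u v y x := fun v x y => by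
    have h1 := (eΩ x y v).1.unique ((eΩ y x v).1.neg.congr_of_eventuallyEq (by
      filter_upwards [hO.mem_nhds hu] with w hw
      exact hskew w hw x y))
    exact congrArg (fun l : E →L[ℝ] ℝ => l v) h1
  have ddskew : ∀ v w x y, fderiv ℝ (fderiv ℝ Ω) u v w x y =
      -fderiv ℝ (fderiv ℝ Ω) u v w y x := fun v w x y => by
    have h1 := (eD w x y).unique ((eD w y x).neg.congr_of_eventuallyEq (by
      filter_upwards [hO.mem_nhds hu] with z hz
      have h2 := ((((hΩ.contDiffAt (hO.mem_nhds hz)).differentiableAt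
        (by simp)).hasFDerivAt.clm_apply (hasFDerivAt_const x z)).clm_apply (hasFDerivAt_const y z))
      have h3 := ((((hΩ.contDiffAt (hO.mem_nhds hz)).differentiableAt
        (by simp)).hasFDerivAt.clm_apply (hasFDerivAt_const y z)).clm_apply (hasFDerivAt_const x z))
      have h4 := h2.unique (h3.neg.congr_of_eventuallyEq (by
        filter_upwards [hO.mem_nhds hz] with t ht
        exact hskew t ht x y))
      have h5 := congrArg (fun l : E →L[ℝ] ℝ => l w) h4
      simpa using h5))
    exact congrArg (fun l : E →L[ℝ] ℝ => l v) h1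
  have sab := congrArg (fun t => t c d) (hsymm a b)
  have sac := congrArg (fun t => t b d) (hsymm a c)
  have sad := congrArg (fun t => t b c) (hsymm a d)
  have sbc := congrArg (fun t => t a d) (hsymm b c)
  have sbd := congrArg (fun t => t a c) (hsymm b d)
  have scd := congrArg (fun t => t a b) (hsymm c d)
  have k1 := key a b c d
  have k2 := key b c d a
  have k3 := key c d a b
  have k4 := key d a b c
  have t1 := hd u hu b c d
  have t2 := hd u hu c d a
  have t3 := hd u hu d a b
  have t4 := hd u hu a b c
  simp only [ddskew _ _ d a, ddskew _ _ c a, ddskew _ _ b a, ddskew _ _ d b, ddskew _ _ c b,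
    ddskew _ _ d c, dskew _ d a, dskew _ c a, dskew _ b a, dskew _ d b, dskew _ c b,
    dskew _ d c, hskew u hu d a, hskew u hu c a, hskew u hu b a, hskew u hu d b, hskew u hu c b,
    hskew u hu d c] at k1 k2 k3 k4 t1 t2 t3 t4
  clear hΩ hskew hN hd hΩu hNu hΩ1 hN1 hΩ2 hsymm eΩ eD eN key dskew ddskew
  obtain ⟨X, hX⟩ : ∃ X : E → E → E → E → ℝ, ∀ a b c d,
    fderiv ℝ (fderiv ℝ Ω) u a b c d = X a b c d := ⟨_, fun _ _ _ _ => rfl⟩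
  obtain ⟨Y, hY⟩ : ∃ Y : E → E → E → ℝ, ∀ a b c, fderiv ℝ Ω u a b c = Y a b c :=
    ⟨_, fun _ _ _ => rfl⟩
  obtain ⟨Z, hZ⟩ : ∃ Z : E → E → ℝ, ∀ a b, fderiv ℝ N u a b = Z a b := ⟨_, fun _ _ => rfl⟩
  obtain ⟨B, hB⟩ : ∃ B : E → E → ℝ, ∀ a b, Ω u a b = B a b := ⟨_, fun _ _ => rfl⟩
  obtain ⟨C, hC⟩ : ∃ C : E → ℝ, ∀ a, N u a = C a := ⟨_, fun _ => rfl⟩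
  simp only [hX, hY, hZ, hB, hC] at *
  -- This is 0 = d(dΩ) = dN ∧ Ω - N ∧ dΩ, followed by N ∧ dΩ = N ∧ N ∧ Ω = 0: the k's are the
  -- differentiated equation, the t's the equation itself, and the s's the symmetry of second
  -- derivatives.
  linear_combination (-1) * k1 + k2 - k3 + k4 + C a * t1 - C b * t2 + C c * t3 - C d * t4
    + sab - sac + sad + sbc - sbd + scd

end ClosedForms

/-! ### Injectivity of the wedge product with a Kähler form. -/

section Nondegenerate

variable {V : Type*} [AddCommGroup V] [Module ℝ V]
  {g : V →ₗ[ℝ] V →ₗ[ℝ] ℝ} {I : V → V}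

/-- The wedge product with the Kähler form is injective on one-forms. -/
lemma eq_zero_of_wedge_one (hV : 4 < Module.finrank ℝ V) (hsymm : ∀ x y, g x y = g y x)
    (hpos : ∀ v, v ≠ 0 → 0 < g v v) (hI : ∀ x, I (I x) = -x)
    (hskew : ∀ x y, g (I x) y = -g x (I y)) {l : V → ℝ}
    (hl : ∀ a b c, l a * g b (I c) + l b * g c (I a) + l c * g a (I b) = 0) (a : V) :
    l a = 0 := by
  obtain ⟨y, hy, h1, h2, -⟩ := exists_orthogonal g hV a (I a) a a
  have h := hl a y (I y)
  have e1 : g y (I (I y)) = -g y y := by rw [hI, map_neg]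
  have e2 : g (I y) (I a) = 0 := by rw [hskew, hI, map_neg, neg_neg, hsymm, h1]
  have e3 : g a (I y) = 0 := by linear_combination hskew a y - h2
  have h3 : l a * g y y = 0 := by
    rw [e1, e2, e3] at h
    linarith
  exact (mul_eq_zero.1 h3).resolve_right (hpos y hy).ne'

/-- The wedge product with the Kähler form is injective on two-forms. -/
lemma eq_zero_of_wedge_two (hV : 4 < Module.finrank ℝ V)
    (hpos : ∀ v, v ≠ 0 → 0 < g v v) (hI : ∀ x, I (I x) = -x)
    (hskew : ∀ x y, g (I x) y = -g x (I y)) {B : V → V → ℝ}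
    (hB : ∀ a b c d, B a b * g c (I d) - B a c * g b (I d) + B a d * g b (I c)
      + B b c * g a (I d) - B b d * g a (I c) + B c d * g a (I b) = 0) (a b : V) :
    B a b = 0 := by
  -- Evaluate at (a, b, y, Iy) with y orthogonal to the complex lines of a and b: only two products
  -- survive.
  have key : ∀ a b y, g a y = 0 → g (I a) y = 0 → g b y = 0 → g (I b) y = 0 →
      B a b * g y y = B y (I y) * g a (I b) := fun a b y h1 h2 h3 h4 => by
    have h := hB a b y (I y)
    have e1 : ∀ x, g x (I (I y)) = -g x y := fun x => by rw [hI, map_neg]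
    have e2 : g a (I y) = 0 := by linear_combination hskew a y - h2
    have e3 : g b (I y) = 0 := by linear_combination hskew b y - h4
    rw [e1, e1, e1, e2, e3, h1, h3] at h
    linarith
  -- On three mutually orthogonal complex lines, the ratios B(y, Iy) / g(y, y) are pairwise
  -- opposite, hence all zero. This requires complex dimension at least three.
  have zero : ∀ y, y ≠ 0 → B y (I y) = 0 := fun y hy => by
    obtain ⟨z, hz, h1, h2, -⟩ := exists_orthogonal g hV y (I y) y y
    obtain ⟨w, hw, k1, k2, k3, k4⟩ := exists_orthogonal g hV y (I y) z (I z)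
    have e1 : ∀ x, g x (I (I x)) = -g x x := fun x => by rw [hI, map_neg]
    have e2 : ∀ x v, g x v = 0 → g (I (I x)) v = 0 := fun x v h => by
      rw [hI, map_neg, LinearMap.neg_apply, h, neg_zero]
    have p1 := key y (I y) z h1 h2 h2 (e2 _ _ h1)
    have p2 := key y (I y) w k1 k2 k2 (e2 _ _ k1)
    have p3 := key z (I z) w k3 k4 k4 (e2 _ _ k3)
    rw [e1] at p1 p2 p3
    have hy' := hpos y hy
    have hz' := hpos z hz
    have hw' := hpos w hw
    have h4 : B y (I y) * (g z z * g w w) = 0 := by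
      linear_combination (g w w * p1 + g z z * p2 - g y y * p3) / 2
    exact (mul_eq_zero.1 h4).resolve_right (by positivity)
  obtain ⟨y, hy, h1, h2, h3, h4⟩ := exists_orthogonal g hV a (I a) b (I b)
  have h5 := key a b y h1 h2 h3 h4
  rw [zero y hy, zero_mul] at h5
  exact (mul_eq_zero.1 h5).resolve_right (hpos y hy).ne'

end Nondegenerate

/-- Let `Ω` be a smooth field of Kähler forms over a convex open set, of real dimension greater than
four, and let `dΩ = N ∧ Ω`. Then `N` is the differential of a smooth function. -/
lemma exists_primitive {E : Type*} [NormedAddCommGroup E] [NormedSpace ℝ E]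
    (hE : 4 < Module.finrank ℝ E) {O : Set E} (hO : IsOpen O) (hconv : Convex ℝ O)
    {Ω : E → E →L[ℝ] E →L[ℝ] ℝ} (hΩ : ContDiffOn ℝ ∞ Ω O)
    (hherm : ∀ u ∈ O, ∃ (g : E →ₗ[ℝ] E →ₗ[ℝ] ℝ) (I : E → E), (∀ x y, g x y = g y x) ∧
      (∀ v, v ≠ 0 → 0 < g v v) ∧ (∀ x, I (I x) = -x) ∧ (∀ x y, g (I x) y = -g x (I y)) ∧
      ∀ x y, Ω u x y = g x (I y))
    {N : E → E →L[ℝ] ℝ}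
    (hd : ∀ u ∈ O, ∀ a b c, fderiv ℝ Ω u a b c + fderiv ℝ Ω u b c a + fderiv ℝ Ω u c a b =
      N u a * Ω u b c + N u b * Ω u c a + N u c * Ω u a b) :
    ∃ F : E → ℝ, ContDiffOn ℝ ∞ F O ∧ ∀ u ∈ O, HasFDerivAt F (N u) u := by
  have : FiniteDimensional ℝ E := Module.finite_of_finrank_pos (by omega)
  have hN : ContDiffOn ℝ ∞ N O := by
    refine contDiffOn_of_wedge hO hΩ hd fun u hu l hl => ?_
    obtain ⟨g, I, h1, h2, h3, h4, h5⟩ := hherm u hu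
    simp only [h5] at hl
    ext a
    exact eq_zero_of_wedge_one hE h1 h2 h3 h4 hl a
  have hskew : ∀ u ∈ O, ∀ a b, Ω u a b = -Ω u b a := fun u hu a b => by
    obtain ⟨g, I, h1, h2, h3, h4, h5⟩ := hherm u hu
    rw [h5, h5, h1 a, h4]
  have hclosed : ∀ u ∈ O, ∀ a b, fderiv ℝ N u a b = fderiv ℝ N u b a := fun u hu a b => by
    obtain ⟨g, I, h1, h2, h3, h4, h5⟩ := hherm u hu
    have h6 := fderiv_wedge_eq_zero hO hΩ hskew hN hd hu
    simp only [h5] at h6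
    exact sub_eq_zero.1 (eq_zero_of_wedge_two hE h2 h3 h4
      (B := fun a b => fderiv ℝ N u a b - fderiv ℝ N u b a) h6 a b)
  obtain ⟨F, hF⟩ := hconv.exists_forall_hasFDerivAt_of_fderiv_symmetric hO
    (hN.differentiableOn (by simp)) hclosed
  refine ⟨F, ?_, hF⟩
  rw [contDiffOn_infty_iff_fderiv_of_isOpen hO]
  refine ⟨fun u hu => (hF u hu).differentiableAt.differentiableWithinAt, ?_⟩
  exact hN.congr fun u hu => (hF u hu).fderiv

/-! ### Covariant derivatives on the manifold and the pointwise result there. -/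

section CovDeriv

variable {E : Type*} [NormedAddCommGroup E] [NormedSpace ℝ E]
  {M : Type*} [TopologicalSpace M] [ChartedSpace E M] [IsManifold 𝓘(ℝ, E) ∞ M]

lemma SmoothEnd.diffAt {A : EndField E M} (hA : SmoothEnd A)
    {Y : ∀ x : M, TangentSpace 𝓘(ℝ, E) x} {x : M} (hY : DiffAt Y x) :
    DiffAt (fun y => A y (Y y)) x := by
  have : IsManifold 𝓘(ℝ, E) 1 M := IsManifold.of_le (n := ∞) (by simp)
  exact MDifferentiableAt.clm_bundle_apply ((hA x).mdifferentiableAt (by simp)) hY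

lemma exists_diffAt [FiniteDimensional ℝ E] (x : M) (v : TangentSpace 𝓘(ℝ, E) x) :
    ∃ Y : ∀ x : M, TangentSpace 𝓘(ℝ, E) x, DiffAt Y x ∧ Y x = v := by
  have : IsManifold 𝓘(ℝ, E) 1 M := IsManifold.of_le (n := ∞) (by simp)
  exact ⟨FiberBundle.extend E v, FiberBundle.mdifferentiableAt_extend 𝓘(ℝ, E) E v,
    FiberBundle.extend_apply_self E v⟩

lemma IsCovDerivAt.unique [FiniteDimensional ℝ E] {nabla : Connection E M} {om : FormField E M}
    {x : M} {ξ ξ' : TangentSpace 𝓘(ℝ, E) x →ₗ[ℝ] TangentSpace 𝓘(ℝ, E) x →ₗ[ℝ]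
      TangentSpace 𝓘(ℝ, E) x →ₗ[ℝ] ℝ} (h : IsCovDerivAt nabla om x ξ)
    (h' : IsCovDerivAt nabla om x ξ') : ξ = ξ' := by
  ext v y z
  obtain ⟨Y, hY, rfl⟩ := exists_diffAt x y
  obtain ⟨Z, hZ, rfl⟩ := exists_diffAt x z
  rw [h Y Z hY hZ, h' Y Z hY hZ]

lemma IsCovDerivAt.skew [FiniteDimensional ℝ E] {nabla : Connection E M} {om : FormField E M}
    {x : M} {ξ : TangentSpace 𝓘(ℝ, E) x →ₗ[ℝ] TangentSpace 𝓘(ℝ, E) x →ₗ[ℝ]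
      TangentSpace 𝓘(ℝ, E) x →ₗ[ℝ] ℝ} (h : IsCovDerivAt nabla om x ξ)
    (hom : ∀ y a b, om y a b = -om y b a) (v y z : TangentSpace 𝓘(ℝ, E) x) :
    ξ v z y = -ξ v y z := by
  obtain ⟨Y, hY, rfl⟩ := exists_diffAt x y
  obtain ⟨Z, hZ, rfl⟩ := exists_diffAt x z
  have e : (fun w => om w (Z w) (Y w)) = -fun w => om w (Y w) (Z w) := by
    funext w
    exact hom w _ _
  rw [h Y Z hY hZ, h Z Y hZ hY, e, mvfderiv_neg, hom x (nabla Z x v), hom x (Z x)]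
  simp
  ring

/-- The covariant derivative of a Kähler form in terms of the derivative of the endomorphism. -/
lemma isCovDerivAt_kahlerForm_iff {g : FormField E M} {nabla : Connection E M} {U : Set M}
    (hnabla : IsLeviCivitaOn g nabla U) {A : EndField E M} {x : M} (hx : x ∈ U)
    (hA : ∀ Y : (∀ x : M, TangentSpace 𝓘(ℝ, E) x), DiffAt Y x → DiffAt (fun y => A y (Y y)) x)
    {ξ : TangentSpace 𝓘(ℝ, E) x →ₗ[ℝ] TangentSpace 𝓘(ℝ, E) x →ₗ[ℝ]
      TangentSpace 𝓘(ℝ, E) x →ₗ[ℝ] ℝ} :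
    IsCovDerivAt nabla (kahlerForm g A) x ξ ↔
      ∀ Y Z : (∀ x : M, TangentSpace 𝓘(ℝ, E) x), DiffAt Y x → DiffAt Z x → ∀ v,
        ξ v (Y x) (Z x) = g x (Y x) (nabla (fun y => A y (Z y)) x v)
          - g x (Y x) (A x (nabla Z x v)) := by
  refine forall₂_congr fun Y Z => forall₂_congr fun hY hZ => forall_congr' fun v => ?_
  have h := hnabla.metric x hx Y _ hY (hA Z hZ) v
  have e1 : kahlerForm g A x (nabla Y x v) (Z x) = g x (nabla Y x v) (A x (Z x)) := rfl
  have e2 : kahlerForm g A x (Y x) (nabla Z x v) = g x (Y x) (A x (nabla Z x v)) := rfl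
  have e3 : (fun y => kahlerForm g A y (Y y) (Z y)) = fun y => g y (Y y) (A y (Z y)) := rfl
  rw [e1, e2, e3, h]
  constructor <;> intro h' <;> rw [h'] <;> ring

namespace AlmostHyperHermitian

variable (S : AlmostHyperHermitian E M)

lemma g_apply (x : M) (v w : TangentSpace 𝓘(ℝ, E) x) : S.g x v w = S.metric.inner x v w := rfl

lemma K_apply (x : M) (v : TangentSpace 𝓘(ℝ, E) x) : S.K x v = S.I x (S.J x v) := rfl

lemma diffAt_K {Y : ∀ x : M, TangentSpace 𝓘(ℝ, E) x} {x : M} (hY : DiffAt Y x) :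
    DiffAt (fun y => S.K y (Y y)) x :=
  S.smooth_I.diffAt (S.smooth_J.diffAt hY)

lemma mdifferentiableAt_g {Y Z : ∀ x : M, TangentSpace 𝓘(ℝ, E) x} {x : M} (hY : DiffAt Y x)
    (hZ : DiffAt Z x) : MDifferentiableAt 𝓘(ℝ, E) 𝓘(ℝ, ℝ) (fun y => S.g y (Y y) (Z y)) x := by
  have : IsManifold 𝓘(ℝ, E) 1 M := IsManifold.of_le (n := ∞) (by simp)
  have h := MDifferentiableAt.clm_bundle_apply₂ (E₃ := fun _ : M => ℝ) (F₃ := ℝ)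
    ((S.metric.contMDiff x).mdifferentiableAt (by simp)) hY hZ
  exact (mdifferentiableAt_totalSpace _ _).1 h |>.2

lemma isHermitianFrame (x : M) : IsHermitianFrame (S.g x) (S.I x).toLinearMap (S.J x).toLinearMap
    (S.K x).toLinearMap := by
  have hI : ∀ v w, S.g x (S.I x v) w = -S.g x v (S.I x w) := fun v w => by
    have h := S.orthogonal_I x v (S.I x w)
    rw [S.I_sq, map_neg] at h
    rw [g_apply, g_apply, ← h, neg_neg]
  have hJ : ∀ v w, S.g x (S.J x v) w = -S.g x v (S.J x w) := fun v w => by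
    have h := S.orthogonal_J x v (S.J x w)
    rw [S.J_sq, map_neg] at h
    rw [g_apply, g_apply, ← h, neg_neg]
  have hIJ := S.anticomm x
  have hJI : ∀ v, S.J x (S.I x v) = -S.I x (S.J x v) := fun v => by rw [hIJ, neg_neg]
  refine ⟨⟨S.I_sq x, S.J_sq x, fun v => ?_, fun v => rfl, fun v => ?_, fun v => ?_, fun v => ?_,
    fun v => ?_, fun v => ?_⟩, fun v w => S.metric.symm x v w, fun v hv => S.metric.pos x v hv,
    hI, hJ, fun v w => ?_⟩
  · change S.I x (S.J x (S.I x (S.J x v))) = -v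
    rw [hJI, map_neg, S.I_sq, neg_neg, S.J_sq]
  · change S.J x (S.I x (S.J x v)) = S.I x v
    rw [hJI, S.J_sq, map_neg, neg_neg]
  · change S.I x (S.J x (S.I x v)) = S.J x v
    rw [hJI, map_neg, S.I_sq, neg_neg]
  · exact hJI v
  · change S.I x (S.J x (S.J x v)) = -S.I x v
    rw [S.J_sq, map_neg]
  · change S.I x (S.I x (S.J x v)) = -S.J x v
    exact S.I_sq x _
  · change S.g x (S.I x (S.J x v)) w = -S.g x v (S.I x (S.J x w))
    rw [hI, hJ, hJI, map_neg, neg_neg]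

/-- The three Kähler forms have the covariant derivatives of the Kähler forms of a structure that is
conformally parallel, the logarithmic derivative of the conformal factor being `4 φ`. -/
def IsConformalAt (nabla : Connection E M) (x : M)
    (φ : TangentSpace 𝓘(ℝ, E) x →ₗ[ℝ] ℝ) : Prop :=
  ∀ A ∈ ({S.I, S.J, S.K} : Set (EndField E M)),
    ∀ Y Z : (∀ x : M, TangentSpace 𝓘(ℝ, E) x), DiffAt Y x → DiffAt Z x → ∀ v,
    confForm (S.g x) (A x).toLinearMap φ v (Y x) (Z x) =
      mvfderiv 𝓘(ℝ, E) (fun y => S.g y (Y y) (A y (Z y))) x v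
      - S.g x (nabla Y x v) (A x (Z x)) - S.g x (Y x) (A x (nabla Z x v))

lemma exists_isConformalAt (hE : 4 < Module.finrank ℝ E) {nabla : Connection E M}
    (hnabla : IsLeviCivitaOn S.g nabla Set.univ)
    (h :
      (∃ i ∈ ({1, 2, 3} : Finset ℕ),
        NablaOmegaMem S.g nabla S.I {4} ∧ NablaOmegaMem S.g nabla S.J {i, 4}) ∨
      (∃ i ∈ ({1, 2, 3} : Finset ℕ),
        NablaOmegaMem S.g nabla S.I {i, 4} ∧ NablaOmegaMem S.g nabla S.J {i, 4} ∧
        NablaOmegaMem S.g nabla S.K {1, 2, 4}) ∨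
      (∃ i ∈ ({1, 2} : Finset ℕ), ∃ j ∈ ({1, 2, 3} : Finset ℕ), i ≠ j ∧
        NablaOmegaMem S.g nabla S.I {i, 4} ∧ NablaOmegaMem S.g nabla S.J {3, 4} ∧
        NablaOmegaMem S.g nabla S.K {j, 3, 4}) ∨
      (∃ i ∈ ({1, 2, 3} : Finset ℕ), ∃ j ∈ ({1, 2, 3} : Finset ℕ), i ≠ j ∧
        NablaOmegaMem S.g nabla S.I {1, 4} ∧ NablaOmegaMem S.g nabla S.J {2, 4} ∧
        NablaOmegaMem S.g nabla S.K {i, j, 4}) ∨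
      (∃ C ∈ ({{1, 2}, {1, 3}, {2, 3}} : Finset (Finset ℕ)),
        ∃ D ∈ ({{1, 2}, {1, 3}, {2, 3}} : Finset (Finset ℕ)), C ≠ D ∧
        NablaOmegaMem S.g nabla S.I {4} ∧ NablaOmegaMem S.g nabla S.J (C ∪ {4}) ∧
        NablaOmegaMem S.g nabla S.K (D ∪ {4}))) (x : M) :
    ∃ φ : TangentSpace 𝓘(ℝ, E) x →ₗ[ℝ] ℝ, S.IsConformalAt nabla x φ := by
  have : FiniteDimensional ℝ E := Module.finite_of_finrank_pos (by omega)
  have hf := S.isHermitianFrame x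
  have hαβ : (∃ α, IsCovDerivAt nabla (kahlerForm S.g S.I) x α) ∧
      ∃ β, IsCovDerivAt nabla (kahlerForm S.g S.J) x β := by
    have aux : ∀ {A : EndField E M} {s : Finset ℕ}, NablaOmegaMem S.g nabla A s →
        ∃ ξ, IsCovDerivAt nabla (kahlerForm S.g A) x ξ := fun h => by
      obtain ⟨ξ, -, hξ⟩ := h x
      exact ⟨ξ, hξ⟩
    rcases h with ⟨_, _, h1, h2⟩ | ⟨_, _, h1, h2, _⟩ | ⟨_, _, _, _, _, h1, h2, _⟩ |
      ⟨_, _, _, _, _, h1, h2, _⟩ | ⟨_, _, _, _, _, h1, h2, _⟩ <;> exact ⟨aux h1, aux h2⟩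
  obtain ⟨⟨α, hα⟩, β, hβ⟩ := hαβ
  -- The first hypothesis says nothing about K, so ∇ω_K is built from the product rule ∇K = (∇I)J +
  -- I(∇J); skewness of I moves it to the other slot and produces the minus sign.
  let γ : TangentSpace 𝓘(ℝ, E) x →ₗ[ℝ] TangentSpace 𝓘(ℝ, E) x →ₗ[ℝ]
      TangentSpace 𝓘(ℝ, E) x →ₗ[ℝ] ℝ :=
    LinearMap.mk₂ ℝ (fun v y => α v y ∘ₗ (S.J x).toLinearMap - β v (S.I x y))
      (by intros; ext; simp; ring) (by intros; ext; simp; ring) (by intros; ext; simp; ring)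
      (by intros; ext; simp; ring)
  have hrel : ∀ v y z, γ v y z = α v y (S.J x z) - β v (S.I x y) z := fun v y z => rfl
  have hγ : IsCovDerivAt nabla (kahlerForm S.g S.K) x γ := by
    rw [isCovDerivAt_kahlerForm_iff hnabla (mem_univ x) fun _ h => S.diffAt_K h]
    rw [isCovDerivAt_kahlerForm_iff hnabla (mem_univ x) fun _ h => S.smooth_I.diffAt h] at hα
    rw [isCovDerivAt_kahlerForm_iff hnabla (mem_univ x) fun _ h => S.smooth_J.diffAt h] at hβ
    intro Y Z hY hZ v
    have e1 := hα Y (fun y => S.J y (Z y)) hY (S.smooth_J.diffAt hZ) v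
    have e2 := hβ (fun y => S.I y (Y y)) Z (S.smooth_I.diffAt hY) hZ v
    have e3 := hf.skewI (Y x) (nabla (fun y => S.J y (Z y)) x v)
    have e4 := hf.skewI (Y x) (S.J x (nabla Z x v))
    simp only [ContinuousLinearMap.coe_coe] at e3 e4
    rw [hrel, e1, e2, e3, e4]
    simp only [K_apply]
    ring
  have mem : ∀ {A : EndField E M} {s : Finset ℕ} {ξ}, IsCovDerivAt nabla (kahlerForm S.g A) x ξ →
      NablaOmegaMem S.g nabla A s → ξ ∈ ghClass (S.g x) (A x).toLinearMap s := fun hξ h => by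
    obtain ⟨ξ', hm, hξ'⟩ := h x
    rwa [hξ.unique hξ']
  obtain ⟨φ, h1, h2, h3⟩ := exists_confForm hf hE (α := α) (β := β) (γ := γ)
    (hγ.skew fun y a b => by
      have := (S.isHermitianFrame y).skewK b a
      rw [(S.isHermitianFrame y).symm] at this
      exact this) hrel (by
    rcases h with ⟨i, hi, h1, h2⟩ | ⟨i, hi, h1, h2, h3⟩ | ⟨i, hi, j, hj, hij, h1, h2, h3⟩ |
      ⟨i, hi, j, hj, hij, h1, h2, h3⟩ | ⟨i, hi, j, hj, hij, h1, h2, h3⟩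
    · exact Or.inl ⟨i, hi, mem hα h1, mem hβ h2⟩
    · exact Or.inr (Or.inl ⟨i, hi, mem hα h1, mem hβ h2, mem hγ h3⟩)
    · exact Or.inr (Or.inr (Or.inl ⟨i, hi, j, hj, hij, mem hα h1, mem hβ h2, mem hγ h3⟩))
    · exact Or.inr (Or.inr (Or.inr (Or.inl
        ⟨i, hi, j, hj, hij, mem hα h1, mem hβ h2, mem hγ h3⟩)))
    · exact Or.inr (Or.inr (Or.inr (Or.inr
        ⟨i, hi, j, hj, hij, mem hα h1, mem hβ h2, mem hγ h3⟩))))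
  refine ⟨φ, ?_⟩
  rintro A (rfl | rfl | rfl) Y Z hY hZ v
  · rw [← h1]; exact hα Y Z hY hZ v
  · rw [← h2]; exact hβ Y Z hY hZ v
  · rw [← h3]; exact hγ Y Z hY hZ v

end AlmostHyperHermitian

end CovDeriv

/-! ### Coordinate vector fields: smooth, commuting, and acting as partial derivatives. -/

section CoordinateFields

variable {E : Type*} [NormedAddCommGroup E] [NormedSpace ℝ E]
  {M : Type*} [TopologicalSpace M] [ChartedSpace E M]

/-- The constant vector fields on a vector space. -/
def constField (v : E) : ∀ u : E, TangentSpace 𝓘(ℝ, E) u := fun _ => v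

/-- The coordinate vector fields of the chart at `p`. -/
def coordField (p : M) (v : E) : ∀ x : M, TangentSpace 𝓘(ℝ, E) x :=
  VectorField.mpullback 𝓘(ℝ, E) 𝓘(ℝ, E) (extChartAt 𝓘(ℝ, E) p) (constField v)

/-- The frame of coordinate vector fields of the chart at `p`. -/
def coordFrame (p x : M) : E →L[ℝ] TangentSpace 𝓘(ℝ, E) x :=
  (mfderiv 𝓘(ℝ, E) 𝓘(ℝ, E) (extChartAt 𝓘(ℝ, E) p) x).inverse

lemma coordFrame_apply (p x : M) (v : E) : coordFrame p x v = coordField p v x := rfl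

lemma contMDiff_constField (v : E) : ContMDiff 𝓘(ℝ, E) 𝓘(ℝ, E).tangent ∞
    (fun u => (⟨u, constField v u⟩ : TangentBundle 𝓘(ℝ, E) E)) :=
  fun _ => contMDiffAt_vectorSpace_iff_contDiffAt.2 contDiffAt_const

variable [IsManifold 𝓘(ℝ, E) ∞ M] {p x : M}

lemma coordFrame_bijective (hx : x ∈ (extChartAt 𝓘(ℝ, E) p).source) :
    Function.Bijective (coordFrame (E := E) p x) := by
  have : IsManifold 𝓘(ℝ, E) 1 M := IsManifold.of_le (n := ∞) (by simp)
  obtain ⟨e, he⟩ := isInvertible_mfderiv_extChartAt (I := 𝓘(ℝ, E)) hx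
  rw [coordFrame, ← he, ContinuousLinearMap.inverse_equiv]
  exact e.symm.bijective

lemma mvfderiv_coordField (hx : x ∈ (extChartAt 𝓘(ℝ, E) p).source) {f : M → ℝ}
    (hf : MDifferentiableAt 𝓘(ℝ, E) 𝓘(ℝ, ℝ) f x) (v : E) :
    mvfderiv 𝓘(ℝ, E) f x (coordField p v x) =
      fderiv ℝ (f ∘ (extChartAt 𝓘(ℝ, E) p).symm) (extChartAt 𝓘(ℝ, E) p x) v := by
  have : IsManifold 𝓘(ℝ, E) 1 M := IsManifold.of_le (n := ∞) (by simp)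
  have hψ : MDifferentiableAt 𝓘(ℝ, E) 𝓘(ℝ, E) (extChartAt 𝓘(ℝ, E) p).symm
      (extChartAt 𝓘(ℝ, E) p x) := by
    have h := mdifferentiableWithinAt_extChartAt_symm (I := 𝓘(ℝ, E))
      ((extChartAt 𝓘(ℝ, E) p).map_source hx)
    simpa [mdifferentiableWithinAt_univ] using h
  have hfψ : MDifferentiableAt 𝓘(ℝ, E) 𝓘(ℝ, ℝ) (f ∘ (extChartAt 𝓘(ℝ, E) p).symm)
      (extChartAt 𝓘(ℝ, E) p x) :=
    MDifferentiableAt.comp_of_eq (I' := 𝓘(ℝ, E)) _ hf hψ ((extChartAt 𝓘(ℝ, E) p).left_inv hx)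
  have he : MDifferentiableAt 𝓘(ℝ, E) 𝓘(ℝ, E) (extChartAt 𝓘(ℝ, E) p) x :=
    mdifferentiableAt_extChartAt (by simpa using hx)
  have h1 : f =ᶠ[nhds x] (f ∘ (extChartAt 𝓘(ℝ, E) p).symm) ∘ extChartAt 𝓘(ℝ, E) p := by
    filter_upwards [(isOpen_extChartAt_source p).mem_nhds hx] with y hy
    exact congrArg f ((extChartAt 𝓘(ℝ, E) p).left_inv hy).symm
  have h2 : mfderiv 𝓘(ℝ, E) 𝓘(ℝ, E) (extChartAt 𝓘(ℝ, E) p) x (coordField p v x) = v := by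
    obtain ⟨e, he⟩ := isInvertible_mfderiv_extChartAt (I := 𝓘(ℝ, E)) hx
    rw [← coordFrame_apply, coordFrame, ← he, ContinuousLinearMap.inverse_equiv]
    exact e.apply_symm_apply v
  have h3 : mfderiv 𝓘(ℝ, E) 𝓘(ℝ, ℝ) f x (coordField p v x) =
      mfderiv 𝓘(ℝ, E) 𝓘(ℝ, ℝ) (f ∘ (extChartAt 𝓘(ℝ, E) p).symm) (extChartAt 𝓘(ℝ, E) p x) v := by
    refine (DFunLike.congr_fun h1.mfderiv_eq (coordField p v x)).trans ?_
    exact (mfderiv_comp_apply x hfψ he _).trans (congrArg _ h2)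
  rw [← mfderiv_eq_fderiv]
  exact h3

lemma contMDiffAt_coordField [CompleteSpace E] (hx : x ∈ (extChartAt 𝓘(ℝ, E) p).source) (v : E) :
    ContMDiffAt 𝓘(ℝ, E) 𝓘(ℝ, E).tangent ∞
      (fun y => (⟨y, coordField p v y⟩ : TangentBundle 𝓘(ℝ, E) M)) x := by
  have : IsManifold 𝓘(ℝ, E) 1 M := IsManifold.of_le (n := ∞) (by simp)
  have : IsManifold 𝓘(ℝ, E) (∞ + 1) M := by simpa
  exact ContMDiffAt.mpullback_vectorField_preimage (n := ∞) (m := ∞) (contMDiff_constField v _)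
    (contMDiffAt_extChartAt' (by simpa using hx)) (isInvertible_mfderiv_extChartAt hx) (by simp)

lemma diffAt_coordField [CompleteSpace E] (hx : x ∈ (extChartAt 𝓘(ℝ, E) p).source) (v : E) :
    DiffAt (coordField p v) x :=
  (contMDiffAt_coordField hx v).mdifferentiableAt (by simp)

lemma mlieBracket_constField (v w : E) :
    VectorField.mlieBracket 𝓘(ℝ, E) (constField v) (constField w) = 0 := by
  rw [← VectorField.mlieBracketWithin_univ, VectorField.mlieBracketWithin_eq_lieBracketWithin]
  funext u
  change fderivWithin ℝ (fun _ => w) univ u v - fderivWithin ℝ (fun _ => v) univ u w = 0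
  simp

/-- The Lie bracket is natural under pullback by the chart, and constant fields commute. -/
lemma mlieBracket_coordField [CompleteSpace E] (hx : x ∈ (extChartAt 𝓘(ℝ, E) p).source) (v w : E) :
    VectorField.mlieBracket 𝓘(ℝ, E) (coordField p v) (coordField p w) x = 0 := by
  have : IsManifold 𝓘(ℝ, E) 1 M := IsManifold.of_le (n := ∞) (by simp)
  have : IsManifold 𝓘(ℝ, E) (minSmoothness ℝ 2) M := IsManifold.of_le (n := ∞) (by
    rw [minSmoothness_of_isRCLikeNormedField]
    exact WithTop.coe_le_coe.2 (le_top : (2 : ℕ∞) ≤ ⊤))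
  have h := VectorField.mpullback_mlieBracket (n := ∞) (I := 𝓘(ℝ, E)) (I' := 𝓘(ℝ, E))
    (f := extChartAt 𝓘(ℝ, E) p) (x₀ := x)
    ((contMDiff_constField v _).mdifferentiableAt (by simp))
    ((contMDiff_constField w _).mdifferentiableAt (by simp))
    (contMDiffAt_extChartAt' (by simpa using hx)) (by
      rw [minSmoothness_of_isRCLikeNormedField]
      exact WithTop.coe_le_coe.2 (le_top : (2 : ℕ∞) ≤ ⊤))
  rw [mlieBracket_constField, VectorField.mpullback_zero] at h
  exact h.symm

end CoordinateFields

/-! ### The local conformal factor. -/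

section Potential

/-- A bilinear form on a finite-dimensional space, as a continuous bilinear form. -/
def bilinToCLM {E : Type*} [NormedAddCommGroup E] [NormedSpace ℝ E] [FiniteDimensional ℝ E]
    (B : E →ₗ[ℝ] E →ₗ[ℝ] ℝ) : E →L[ℝ] E →L[ℝ] ℝ :=
  LinearMap.toContinuousLinearMap
    ((LinearMap.toContinuousLinearMap : (E →ₗ[ℝ] ℝ) ≃ₗ[ℝ] E →L[ℝ] ℝ).toLinearMap ∘ₗ B)

namespace AlmostHyperHermitian

variable {E : Type*} [NormedAddCommGroup E] [NormedSpace ℝ E] [FiniteDimensional ℝ E]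
  {M : Type*} [TopologicalSpace M] [ChartedSpace E M] [IsManifold 𝓘(ℝ, E) ∞ M]
  (S : AlmostHyperHermitian E M)

/-- The Kähler form of `I` in the chart at `p`. -/
def coordForm (p : M) (u : E) : E →L[ℝ] E →L[ℝ] ℝ :=
  bilinToCLM ((kahlerForm S.g S.I ((extChartAt 𝓘(ℝ, E) p).symm u)).compl₁₂
    (coordFrame p ((extChartAt 𝓘(ℝ, E) p).symm u)).toLinearMap
    (coordFrame p ((extChartAt 𝓘(ℝ, E) p).symm u)).toLinearMap)

lemma coordForm_apply (p : M) (a b : E) : (fun u => S.coordForm p u a b) =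
    (fun x => S.g x (coordField p a x) (S.I x (coordField p b x))) ∘
      (extChartAt 𝓘(ℝ, E) p).symm := rfl

lemma contDiffOn_coordForm (p : M) :
    ContDiffOn ℝ ∞ (S.coordForm p) (extChartAt 𝓘(ℝ, E) p).target := by
  refine contDiffOn_clm_apply.2 fun a => contDiffOn_clm_apply.2 fun b => ?_
  rw [coordForm_apply, ← contMDiffOn_iff_contDiffOn]
  refine ContMDiffOn.comp (t := (extChartAt 𝓘(ℝ, E) p).source) (I' := 𝓘(ℝ, E)) (fun x hx => ?_)
    (contMDiffOn_extChartAt_symm p) fun u hu => (extChartAt 𝓘(ℝ, E) p).map_target hu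
  have : IsManifold 𝓘(ℝ, E) 1 M := IsManifold.of_le (n := ∞) (by simp)
  have h := ContMDiffAt.clm_bundle_apply₂ (E₃ := fun _ : M => ℝ) (F₃ := ℝ)
    (S.metric.contMDiff x) (contMDiffAt_coordField hx a)
    (ContMDiffAt.clm_bundle_apply (S.smooth_I x) (contMDiffAt_coordField hx b))
  exact ((contMDiffAt_totalSpace).1 h |>.2).contMDiffWithinAt

lemma coordForm_hermitian {p x : M} (hx : x ∈ (extChartAt 𝓘(ℝ, E) p).source) :
    ∃ (g : E →ₗ[ℝ] E →ₗ[ℝ] ℝ) (I : E → E), (∀ v w, g v w = g w v) ∧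
      (∀ v, v ≠ 0 → 0 < g v v) ∧ (∀ v, I (I v) = -v) ∧ (∀ v w, g (I v) w = -g v (I w)) ∧
      ∀ v w, S.coordForm p (extChartAt 𝓘(ℝ, E) p x) v w = g v (I w) := by
  have hf := S.isHermitianFrame x
  have hT := coordFrame_bijective (E := E) hx
  let T := Equiv.ofBijective _ hT
  have hTs : ∀ v, coordFrame p x (T.symm v) = v := T.apply_symm_apply
  refine ⟨(S.g x).compl₁₂ (coordFrame p x).toLinearMap (coordFrame p x).toLinearMap,
    fun v => T.symm (S.I x (coordFrame p x v)), fun v w => hf.symm _ _, fun v hv => hf.pos _ ?_,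
    fun v => ?_, fun v w => ?_, fun v w => ?_⟩
  · exact fun h => hv (hT.1 (by simpa using h))
  · refine hT.1 ?_
    rw [hTs, hTs, S.I_sq, map_neg]
  · simp only [LinearMap.compl₁₂_apply, ContinuousLinearMap.coe_coe, hTs]
    exact hf.skewI _ _
  · simp only [LinearMap.compl₁₂_apply, ContinuousLinearMap.coe_coe, hTs]
    have h : ∀ y, y = x → S.g y (coordField p v y) (S.I y (coordField p w y)) =
        S.g x (coordField p v x) (S.I x (coordField p w x)) := by
      rintro _ rfl
      rfl
    exact h _ ((extChartAt 𝓘(ℝ, E) p).left_inv hx)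

lemma fderiv_coordForm {p x : M} (hx : x ∈ (extChartAt 𝓘(ℝ, E) p).source) (a b c : E) :
    fderiv ℝ (S.coordForm p) (extChartAt 𝓘(ℝ, E) p x) a b c =
      mvfderiv 𝓘(ℝ, E) (fun y => S.g y (coordField p b y) (S.I y (coordField p c y))) x
        (coordField p a x) := by
  rw [mvfderiv_coordField hx (S.mdifferentiableAt_g (diffAt_coordField hx b)
    (S.smooth_I.diffAt (diffAt_coordField hx c))), ← coordForm_apply]
  have h := (((S.contDiffOn_coordForm p).contDiffAt ((isOpen_extChartAt_target p).mem_nhds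
    ((extChartAt 𝓘(ℝ, E) p).map_source hx))).differentiableAt (by simp)).hasFDerivAt
  have h2 := ((h.clm_apply (hasFDerivAt_const b _)).clm_apply (hasFDerivAt_const c _)).fderiv
  rw [h2]
  simp

/-- Coordinate fields commute, so torsion-freeness cancels the connection terms in pairs and dω_I is
the cyclic sum of ∇ω_I. In the cyclic sum of `confForm` the terms with g cancel and those with ω_I
double, giving -4 φ ∧ ω_I. -/
lemma cyclic_fderiv_coordForm {nabla : Connection E M}
    (hnabla : IsLeviCivitaOn S.g nabla Set.univ) {p x : M}
    (hx : x ∈ (extChartAt 𝓘(ℝ, E) p).source) {φ : TangentSpace 𝓘(ℝ, E) x →ₗ[ℝ] ℝ}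
    (hφ : S.IsConformalAt nabla x φ) (a b c : E) :
    fderiv ℝ (S.coordForm p) (extChartAt 𝓘(ℝ, E) p x) a b c
      + fderiv ℝ (S.coordForm p) (extChartAt 𝓘(ℝ, E) p x) b c a
      + fderiv ℝ (S.coordForm p) (extChartAt 𝓘(ℝ, E) p x) c a b =
    -4 * (φ (coordField p a x) * S.g x (coordField p b x) (S.I x (coordField p c x))
      + φ (coordField p b x) * S.g x (coordField p c x) (S.I x (coordField p a x))
      + φ (coordField p c x) * S.g x (coordField p a x) (S.I x (coordField p b x))) := by
  have hf := S.isHermitianFrame x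
  have hskew : ∀ v w, S.g x v (S.I x w) = -S.g x w (S.I x v) := fun v w => by
    rw [hf.symm v]
    exact hf.skewI w v
  have hd := fun v => diffAt_coordField (E := E) hx v
  have hs : ∀ v w, nabla (coordField p w) x (coordField p v x) =
      nabla (coordField p v) x (coordField p w x) := fun v w => by
    rw [← sub_eq_zero, hnabla.torsion_free x (mem_univ x) _ _ (hd v) (hd w),
      mlieBracket_coordField hx]
  have k1 := hφ S.I (by simp) _ _ (hd b) (hd c) (coordField p a x)
  have k2 := hφ S.I (by simp) _ _ (hd c) (hd a) (coordField p b x)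
  have k3 := hφ S.I (by simp) _ _ (hd a) (hd b) (coordField p c x)
  simp only [confForm, ContinuousLinearMap.coe_coe] at k1 k2 k3
  rw [S.fderiv_coordForm hx, S.fderiv_coordForm hx, S.fderiv_coordForm hx]
  rw [hs b a] at k2
  rw [hs c a, hs c b] at k3
  rw [hskew (coordField p a x) (coordField p c x)] at k1
  rw [hskew (coordField p b x) (coordField p a x)] at k2
  rw [hskew (coordField p c x) (coordField p b x)] at k3
  have s1 := hf.symm (coordField p a x) (coordField p b x)
  have s2 := hf.symm (coordField p b x) (coordField p c x)
  have s3 := hf.symm (coordField p c x) (coordField p a x)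
  have t1 := hskew (coordField p b x) (nabla (coordField p c) x (coordField p a x))
  have t2 := hskew (coordField p c x) (nabla (coordField p b) x (coordField p a x))
  have t3 := hskew (coordField p a x) (nabla (coordField p c) x (coordField p b x))
  linear_combination -k1 - k2 - k3 + t1 + t2 + t3 - 2 * φ (S.I x (coordField p c x)) * s1
    - 2 * φ (S.I x (coordField p a x)) * s2 - 2 * φ (S.I x (coordField p b x)) * s3

lemma exists_potential (hE : 4 < Module.finrank ℝ E) {nabla : Connection E M}
    (hnabla : IsLeviCivitaOn S.g nabla Set.univ)
    {φ : ∀ x : M, TangentSpace 𝓘(ℝ, E) x →ₗ[ℝ] ℝ} (hφ : ∀ x, S.IsConformalAt nabla x (φ x))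
    (p : M) :
    ∃ U : Set M, IsOpen U ∧ p ∈ U ∧ ∃ f : M → ℝ, ContMDiffOn 𝓘(ℝ, E) 𝓘(ℝ, ℝ) ∞ f U ∧
      ∀ x ∈ U, ∀ v, mvfderiv 𝓘(ℝ, E) f x v = 4 * φ x v := by
  obtain ⟨r, hr, hball⟩ := Metric.isOpen_iff.1 (isOpen_extChartAt_target (I := 𝓘(ℝ, E)) p) _
    (mem_extChartAt_target p)
  -- The coordinate expression of -4φ. A primitive F of it yields f = -F with df = 4φ, the value for
  -- which e^f ω_I is closed.
  let N : E → E →L[ℝ] ℝ := fun u => LinearMap.toContinuousLinearMap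
    ((-4 : ℝ) • φ ((extChartAt 𝓘(ℝ, E) p).symm u) ∘ₗ
      (coordFrame p ((extChartAt 𝓘(ℝ, E) p).symm u)).toLinearMap)
  have hN : ∀ u a, N u a = -4 * φ ((extChartAt 𝓘(ℝ, E) p).symm u)
    (coordField p a ((extChartAt 𝓘(ℝ, E) p).symm u)) := fun u a => rfl
  obtain ⟨F, hF, hF'⟩ := exists_primitive hE Metric.isOpen_ball (convex_ball _ r)
    ((S.contDiffOn_coordForm p).mono hball) (N := N) (fun u hu => by
      have h := S.coordForm_hermitian ((extChartAt 𝓘(ℝ, E) p).map_target (hball hu))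
      rwa [(extChartAt 𝓘(ℝ, E) p).right_inv (hball hu)] at h) (fun u hu a b c => by
      have h := S.cyclic_fderiv_coordForm hnabla
        ((extChartAt 𝓘(ℝ, E) p).map_target (hball hu)) (hφ _) a b c
      rw [(extChartAt 𝓘(ℝ, E) p).right_inv (hball hu)] at h
      rw [h, hN, hN, hN]
      have e : ∀ v w, S.coordForm p u v w = S.g ((extChartAt 𝓘(ℝ, E) p).symm u)
        (coordField p v _) (S.I _ (coordField p w _)) := fun v w => rfl
      rw [e, e, e]
      ring)
  have hU : IsOpen ((extChartAt 𝓘(ℝ, E) p).source ∩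
      extChartAt 𝓘(ℝ, E) p ⁻¹' Metric.ball (extChartAt 𝓘(ℝ, E) p p) r) :=
    isOpen_extChartAt_preimage' p Metric.isOpen_ball
  have hf : ContMDiffOn 𝓘(ℝ, E) 𝓘(ℝ, ℝ) ∞ ((-F) ∘ extChartAt 𝓘(ℝ, E) p)
      ((extChartAt 𝓘(ℝ, E) p).source ∩
        extChartAt 𝓘(ℝ, E) p ⁻¹' Metric.ball (extChartAt 𝓘(ℝ, E) p p) r) :=
    ContMDiffOn.comp (I' := 𝓘(ℝ, E)) (contMDiffOn_iff_contDiffOn.2 hF.neg)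
      ((contMDiffOn_extChartAt (x := p)).mono fun y hy => by simpa using hy.1) fun y hy => hy.2
  refine ⟨_, hU, ⟨mem_extChartAt_source p, Metric.mem_ball_self hr⟩, _, hf, fun x hx v => ?_⟩
  obtain ⟨a, rfl⟩ := (coordFrame_bijective (E := E) hx.1).2 v
  rw [coordFrame_apply, mvfderiv_coordField hx.1
    (((hf x hx).contMDiffAt (hU.mem_nhds hx)).mdifferentiableAt (by simp))]
  have h := ((hF' _ hx.2).neg.congr_of_eventuallyEq (f₁ := ((-F) ∘ extChartAt 𝓘(ℝ, E) p) ∘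
      (extChartAt 𝓘(ℝ, E) p).symm) (by
    filter_upwards [Metric.isOpen_ball.mem_nhds hx.2] with u hu
    exact congrArg (fun t => -F t) ((extChartAt 𝓘(ℝ, E) p).right_inv (hball hu)))).fderiv
  rw [h, neg_apply, hN, (extChartAt 𝓘(ℝ, E) p).left_inv hx.1]
  ring

end AlmostHyperHermitian

end Potential

/-! ### The Levi-Civita connection of the rescaled metric and parallelism. -/

section ConformalChange

/-- The Riesz representation of a linear form. -/
lemma exists_riesz {V : Type*} [AddCommGroup V] [Module ℝ V] [FiniteDimensional ℝ V]
    {g : V →ₗ[ℝ] V →ₗ[ℝ] ℝ} (hpos : ∀ v, v ≠ 0 → 0 < g v v) (θ : V →ₗ[ℝ] ℝ) :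
    ∃ w, ∀ v, g w v = θ v := by
  have hinj : Function.Injective g := by
    rw [injective_iff_map_eq_zero]
    intro v hv
    by_contra h
    simpa [hv] using hpos v h
  obtain ⟨w, hw⟩ := (LinearMap.injective_iff_surjective_of_finrank_eq_finrank
    (Subspace.dual_finrank_eq (K := ℝ) (V := V)).symm).1 hinj θ
  exact ⟨w, fun v => by rw [hw]⟩

lemma mvfderiv_exp_mul {E : Type*} [NormedAddCommGroup E] [NormedSpace ℝ E]
    {M : Type*} [TopologicalSpace M] [ChartedSpace E M] {f h : M → ℝ} {x : M} (hf : MDifferentiableAt 𝓘(ℝ, E) 𝓘(ℝ, ℝ) f x)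
    (hh : MDifferentiableAt 𝓘(ℝ, E) 𝓘(ℝ, ℝ) h x) (v : TangentSpace 𝓘(ℝ, E) x) :
    mvfderiv 𝓘(ℝ, E) (fun y => Real.exp (f y) * h y) x v =
      Real.exp (f x) * (mvfderiv 𝓘(ℝ, E) f x v * h x + mvfderiv 𝓘(ℝ, E) h x v) := by
  have h1 : HasMFDerivAt 𝓘(ℝ, E) 𝓘(ℝ, ℝ) (fun y => Real.exp (f y)) x _ :=
    (Real.hasDerivAt_exp (f x)).hasFDerivAt.hasMFDerivAt.comp x hf.hasMFDerivAt
  have h2 : mvfderiv 𝓘(ℝ, E) (fun y => Real.exp (f y)) x v =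
      Real.exp (f x) * mvfderiv 𝓘(ℝ, E) f x v := by
    rw [mvfderiv, h1.mfderiv]
    exact mul_comm _ _
  rw [mvfderiv_fun_mul h1.mdifferentiableAt hh]
  simp [h2]
  ring

namespace AlmostHyperHermitian

variable {E : Type*} [NormedAddCommGroup E] [NormedSpace ℝ E] [FiniteDimensional ℝ E]
  {M : Type*} [TopologicalSpace M] [ChartedSpace E M] [IsManifold 𝓘(ℝ, E) ∞ M]
  (S : AlmostHyperHermitian E M)

lemma exists_grad (f : M → ℝ) (x : M) :
    ∃ G : TangentSpace 𝓘(ℝ, E) x, ∀ v, S.g x G v = mvfderiv 𝓘(ℝ, E) f x v :=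
  have : FiniteDimensional ℝ (TangentSpace 𝓘(ℝ, E) x) := inferInstanceAs (FiniteDimensional ℝ E)
  exists_riesz (S.isHermitianFrame x).pos (mvfderiv 𝓘(ℝ, E) f x).toLinearMap

/-- The gradient of a function. -/
def grad (f : M → ℝ) (x : M) : TangentSpace 𝓘(ℝ, E) x := (S.exists_grad f x).choose

lemma g_grad (f : M → ℝ) (x : M) (v : TangentSpace 𝓘(ℝ, E) x) :
    S.g x (S.grad f x) v = mvfderiv 𝓘(ℝ, E) f x v := (S.exists_grad f x).choose_spec v

/-- The Levi-Civita connection of `e^f g`, if `nabla` is that of `g`. -/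
def confConnection (nabla : Connection E M) (f : M → ℝ) : Connection E M := fun Y x =>
  nabla Y x + (1 / 2 : ℝ) • ((mvfderiv 𝓘(ℝ, E) f x).smulRight (Y x)
    + mvfderiv 𝓘(ℝ, E) f x (Y x) • ContinuousLinearMap.id ℝ (TangentSpace 𝓘(ℝ, E) x)
    - (S.metric.inner x (Y x)).smulRight (S.grad f x))

lemma confConnection_apply (nabla : Connection E M) (f : M → ℝ)
    (Y : ∀ x : M, TangentSpace 𝓘(ℝ, E) x) (x : M) (v : TangentSpace 𝓘(ℝ, E) x) :
    S.confConnection nabla f Y x v = nabla Y x v + (1 / 2 : ℝ) • (mvfderiv 𝓘(ℝ, E) f x v • Y x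
      + mvfderiv 𝓘(ℝ, E) f x (Y x) • v - S.g x (Y x) v • S.grad f x) := rfl

variable {nabla : Connection E M} {U : Set M} {f : M → ℝ}

/-- The correction is symmetric in v and Y, so the torsion is unchanged. Paired with g it
contributes df(v) g(Y, Z), exactly the derivative of the factor e^f. -/
lemma isLeviCivitaOn_confConnection (hnabla : IsLeviCivitaOn S.g nabla U)
    (hf : ∀ x ∈ U, MDifferentiableAt 𝓘(ℝ, E) 𝓘(ℝ, ℝ) f x) :
    IsLeviCivitaOn (fun x => Real.exp (f x) • S.g x) (S.confConnection nabla f) U where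
  isCovariantDerivativeOn :=
    { add := fun {Y Z x} hY hZ hx => by
        ext v
        simp only [add_apply, confConnection_apply,
          hnabla.isCovariantDerivativeOn.add hY hZ hx, Pi.add_apply, map_add,
          LinearMap.add_apply]
        module
      leibniz := fun {Y h x} hY hh hx => by
        ext v
        simp only [add_apply, confConnection_apply,
          hnabla.isCovariantDerivativeOn.leibniz hY hh hx, Pi.smul_apply', map_smul,
          LinearMap.smul_apply, smul_apply, smul_eq_mul,
          ContinuousLinearMap.smulRight_apply]
        module }
  torsion_free x hx X Y hX hY := by
    rw [← hnabla.torsion_free x hx X Y hX hY, confConnection_apply, confConnection_apply,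
      (S.isHermitianFrame x).symm (X x)]
    module
  metric x hx Y Z hY hZ v := by
    have h := hnabla.metric x hx Y Z hY hZ v
    have hs := (S.isHermitianFrame x).symm
    have e : (fun y => (Real.exp (f y) • S.g y) (Y y) (Z y)) =
      fun y => Real.exp (f y) * S.g y (Y y) (Z y) := rfl
    rw [e, mvfderiv_exp_mul (hf x hx) (S.mdifferentiableAt_g hY hZ), h]
    simp only [confConnection_apply, LinearMap.smul_apply, smul_eq_mul, map_add, map_sub, map_smul,
      LinearMap.add_apply, LinearMap.sub_apply, g_grad, hs _ (S.grad f x), hs v]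
    ring

/-- With df = 4φ, the contribution of the connection correction and of the factor e^f to ∇ω_A is e^f
times the negative of `confForm`. The computation uses only that A is g-skew, so it serves I, J and
K alike. -/
lemma isHyperKahlerOn_of_isConformalAt (hnabla : IsLeviCivitaOn S.g nabla U)
    (hf : ∀ x ∈ U, MDifferentiableAt 𝓘(ℝ, E) 𝓘(ℝ, ℝ) f x)
    {φ : ∀ x : M, TangentSpace 𝓘(ℝ, E) x →ₗ[ℝ] ℝ} (hφ : ∀ x ∈ U, S.IsConformalAt nabla x (φ x))
    (hdf : ∀ x ∈ U, ∀ v, mvfderiv 𝓘(ℝ, E) f x v = 4 * φ x v) :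
    S.IsHyperKahlerOn (fun x => Real.exp (f x) • S.g x) U := by
  refine ⟨S.confConnection nabla f, S.isLeviCivitaOn_confConnection hnabla hf, fun x hx => ?_⟩
  have hs := (S.isHermitianFrame x).symm
  have key : ∀ A ∈ ({S.I, S.J, S.K} : Set (EndField E M)),
      (∀ Y : (∀ x : M, TangentSpace 𝓘(ℝ, E) x), DiffAt Y x → DiffAt (fun y => A y (Y y)) x) →
      (∀ v w, S.g x (A x v) w = -S.g x v (A x w)) →
      IsCovDerivAt (S.confConnection nabla f)
        (kahlerForm (fun x => Real.exp (f x) • S.g x) A) x 0 := by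
    intro A hA hdiff hskew Y Z hY hZ v
    have h := hφ x hx A hA Y Z hY hZ v
    have e : (fun y => kahlerForm (fun x => Real.exp (f x) • S.g x) A y (Y y) (Z y)) =
      fun y => Real.exp (f y) * S.g y (Y y) (A y (Z y)) := rfl
    have e1 : ∀ a b, kahlerForm (fun x => Real.exp (f x) • S.g x) A x a b =
      Real.exp (f x) * S.g x a (A x b) := fun a b => rfl
    have h1 := hskew (Y x) v
    have h2 := hskew (Y x) (S.grad f x)
    rw [hs (A x (Y x)) (S.grad f x), g_grad, hdf x hx] at h2
    rw [hs (A x (Y x)) v] at h1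
    rw [e, mvfderiv_exp_mul (hf x hx) (S.mdifferentiableAt_g hY (hdiff Z hZ)), e1, e1,
      ← sub_eq_zero]
    simp only [confForm, ContinuousLinearMap.coe_coe] at h
    simp only [confConnection_apply, map_add, map_sub, map_smul, smul_eq_mul, LinearMap.zero_apply,
      LinearMap.add_apply, LinearMap.sub_apply, LinearMap.smul_apply, g_grad, hdf x hx,
      hs (Y x) v, hs (Z x) v]
    linear_combination Real.exp (f x) * h + 2 * Real.exp (f x) * φ x (Z x) * h1
      - 1 / 2 * Real.exp (f x) * S.g x v (Z x) * h2
  exact ⟨key _ (by simp) (fun _ h => S.smooth_I.diffAt h) (S.isHermitianFrame x).skewI,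
    key _ (by simp) (fun _ h => S.smooth_J.diffAt h) (S.isHermitianFrame x).skewJ,
    key _ (by simp) (fun _ h => S.diffAt_K h) (S.isHermitianFrame x).skewK⟩

end AlmostHyperHermitian

end ConformalChange

lemma IsLeviCivitaOn.mono {E : Type*} [NormedAddCommGroup E] [NormedSpace ℝ E]
    {M : Type*} [TopologicalSpace M] [ChartedSpace E M] [IsManifold 𝓘(ℝ, E) ∞ M]
    {g : FormField E M} {nabla : Connection E M} {U U' : Set M}
    (h : IsLeviCivitaOn g nabla U) (hU : U' ⊆ U) : IsLeviCivitaOn g nabla U' where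
  isCovariantDerivativeOn := h.isCovariantDerivativeOn.mono hU
  torsion_free x hx := h.torsion_free x (hU hx)
  metric x hx := h.metric x (hU hx)

end HyperHermitian

end

open HyperHermitian in
theorem theorem4p4 (n : ℕ) (hn : 2 ≤ n)
    (M : Type*) [TopologicalSpace M] [T2Space M] [SecondCountableTopology M]
    [ChartedSpace (EuclideanSpace ℝ (Fin (4 * n))) M]
    [IsManifold 𝓘(ℝ, EuclideanSpace ℝ (Fin (4 * n))) ∞ M]
    (S : AlmostHyperHermitian (EuclideanSpace ℝ (Fin (4 * n))) M)
    (nabla : Connection (EuclideanSpace ℝ (Fin (4 * n))) M)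
    (hnabla : IsLeviCivitaOn S.g nabla Set.univ)
    (h :
      (∃ i ∈ ({1, 2, 3} : Finset ℕ),
        NablaOmegaMem S.g nabla S.I {4} ∧ NablaOmegaMem S.g nabla S.J {i, 4}) ∨
      (∃ i ∈ ({1, 2, 3} : Finset ℕ),
        NablaOmegaMem S.g nabla S.I {i, 4} ∧ NablaOmegaMem S.g nabla S.J {i, 4} ∧
        NablaOmegaMem S.g nabla S.K {1, 2, 4}) ∨
      (∃ i ∈ ({1, 2} : Finset ℕ), ∃ j ∈ ({1, 2, 3} : Finset ℕ), i ≠ j ∧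
        NablaOmegaMem S.g nabla S.I {i, 4} ∧ NablaOmegaMem S.g nabla S.J {3, 4} ∧
        NablaOmegaMem S.g nabla S.K {j, 3, 4}) ∨
      (∃ i ∈ ({1, 2, 3} : Finset ℕ), ∃ j ∈ ({1, 2, 3} : Finset ℕ), i ≠ j ∧
        NablaOmegaMem S.g nabla S.I {1, 4} ∧ NablaOmegaMem S.g nabla S.J {2, 4} ∧
        NablaOmegaMem S.g nabla S.K {i, j, 4}) ∨
      (∃ C ∈ ({{1, 2}, {1, 3}, {2, 3}} : Finset (Finset ℕ)),
        ∃ D ∈ ({{1, 2}, {1, 3}, {2, 3}} : Finset (Finset ℕ)), C ≠ D ∧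
        NablaOmegaMem S.g nabla S.I {4} ∧ NablaOmegaMem S.g nabla S.J (C ∪ {4}) ∧
        NablaOmegaMem S.g nabla S.K (D ∪ {4}))) :
    S.IsLocallyConformalHyperKahler := by
  have hE : 4 < Module.finrank ℝ (EuclideanSpace ℝ (Fin (4 * n))) := by
    rw [finrank_euclideanSpace_fin]
    omega
  intro p
  -- The one-form is chosen point by point with no regularity; its smoothness is recovered later
  -- from dΩ = N ∧ Ω.
  choose φ hφ using S.exists_isConformalAt hE hnabla h
  obtain ⟨U, hU, hpU, f, hf, hdf⟩ := S.exists_potential hE hnabla hφ p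
  exact ⟨U, hU, hpU, f, hf, S.isHyperKahlerOn_of_isConformalAt (hnabla.mono (subset_univ U))
    (fun x hx => ((hf x hx).contMDiffAt (hU.mem_nhds hx)).mdifferentiableAt (by simp))
    (fun x _ => hφ x) hdf⟩
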